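/- Let $V_0>0$ and $R>0$, and put $\lambda_1(R)=\left(\frac{\pi}{2R}\right)^2$. Consider $$-U''(s)+\frac{V_0}{\sqrt{U(s)}}=\lambda U(s),\quad s\in(-R,R),\qquad U(\pm R)=0. \tag{1}$$ A \emph{positive solution} is a function $U\in C([-R,R])\cap C^2(-R,R)$ with $U>0$ in $(-R,R)$ that satisfies (1). A \emph{nonnegative solution} is a function $U\ge 0$ in $C([-R,R])\cap C^1(-R,R)$ with $U(\pm R)=0$ such that $\frac{V_0}{\sqrt U}\chi_{\{U>0\}}\in L^1_{\rm loc}(-R,R)$, $U'$ is locally absolutely continuous, and $-U''+\frac{V_0}{\sqrt U}\chi_{\{U>0\}}=\lambda U$ a.e. in $(-R,R)$; it is nontrivial if $U\not\equiv0$. Then $\lambda_1(R)$ is the first eigenvalue of $-\varphi''=\lambda\varphi$ in $(-R,R)$, $\varphi(\pm R)=0$, and there are a number $\lambda^*>\lambda_1(R)$ and a continuous function $\Lambda:(\lambda_1(R),\infty)\to\mathbb R$ (the bifurcation curve) such that the set of all pairs $(\lambda,\|U\|_{L^\infty(-R,R)})$, with $U$ a nontrivial nonnegative solution for the parameter $\lambda\in\mathbb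 R$, is exactly the graph of $\Lambda$; every positive solution $U$ for a parameter $\lambda$ satisfies $\|U\|_{L^\infty(-R,R)}=\Lambda(\lambda)$; positive solutions exist if and only if $\lambda_1(R)<\lambda\le\lambda^*$; and: i) (bifurcation from infinity) $\Lambda(\lambda)\to+\infty$ as $\lambda\downarrow\lambda_1(R)$. Moreover $\lambda_1(R)$ is the only real number $\lambda_0$ for which there are positive solutions $U_n$ for parameters $\lambda_n\to\lambda_0$ with $\|U_n\|_{L^\infty(-R,R)}\to\infty$. ii) $\Lambda$ is strictly decreasing on $(\lambda_1(R),\infty)$. For every $\lambda$ there is at most one positive solution, and for every $\lambda\le\lambda^*$ there is at most one nontrivial nonnegative solution. iii) $\Lambda$ is not $C^1$ at $\lambda^*$: its one-sided derivatives there exist, are finite, and satisfy $\Lambda'(\lambda^*-)<\Lambda'(\lambda^*+)$. There is a flat solution for $\lambda=\lambda^*$, that is, a positive solution with $U'(\pm R)=0$, and a positive solution for a parameter $\lambda$ is flat if and only if $\lambda=\lambda^*$. -/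

import Mathlib

open Set Filter Topology MeasureTheory

namespace SingularEigenvalue

/-- The number `λ₁(R) = (π / (2R))²`. -/
noncomputable def lambdaOne (R : ℝ) : ℝ := (Real.pi / (2 * R)) ^ 2

/-- `lam` is an eigenvalue of the linear problem `-φ'' = lam φ` in `(-R, R)`, `φ(±R) = 0`
(classical eigenfunctions, not identically zero). -/
def IsDirichletEigenvalue (R lam : ℝ) : Prop :=
  ∃ φ : ℝ → ℝ, ContinuousOn φ (Icc (-R) R) ∧ ContDiffOn ℝ 2 φ (Ioo (-R) R) ∧
    φ (-R) = 0 ∧ φ R = 0 ∧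
    (∀ s ∈ Ioo (-R) R, -deriv (deriv φ) s = lam * φ s) ∧
    ∃ s ∈ Ioo (-R) R, φ s ≠ 0

/-- `U` is a (classical) positive solution of
`-U'' + V₀ / √U = lam U` in `(-R, R)`, `U(±R) = 0`, `U > 0` in `(-R, R)`.
Only the values of `U` on `[-R, R]` matter. -/
structure IsPositiveSolution (V₀ R lam : ℝ) (U : ℝ → ℝ) : Prop where
  continuousOn : ContinuousOn U (Icc (-R) R)
  contDiffOn : ContDiffOn ℝ 2 U (Ioo (-R) R)
  left_eq : U (-R) = 0
  right_eq : U R = 0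
  pos : ∀ s ∈ Ioo (-R) R, 0 < U s
  equation : ∀ s ∈ Ioo (-R) R, -deriv (deriv U) s + V₀ / √(U s) = lam * U s

open Classical in
/-- The singular term `(V₀ / √u) χ_{u > 0}`. -/
noncomputable def singularTerm (V₀ u : ℝ) : ℝ := if 0 < u then V₀ / √u else 0

/-- `U` is a nonnegative (strong, possibly free boundary) solution of
`-U'' + (V₀ / √U) χ_{U > 0} = lam U` in `(-R, R)`, `U(±R) = 0`: `U` is continuous on `[-R, R]`,
differentiable in `(-R, R)`, the singular term is locally integrable in `(-R, R)`, and `U'` is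
locally absolutely continuous in `(-R, R)` with `U'' = (V₀ / √U) χ_{U > 0} - lam U` almost
everywhere, which is written in integrated form.
The zero function is such a solution. -/
structure IsNonnegSolution (V₀ R lam : ℝ) (U : ℝ → ℝ) : Prop where
  continuousOn : ContinuousOn U (Icc (-R) R)
  left_eq : U (-R) = 0
  right_eq : U R = 0
  nonneg : ∀ s ∈ Icc (-R) R, 0 ≤ U s
  differentiableAt : ∀ s ∈ Ioo (-R) R, DifferentiableAt ℝ U s
  integrable : ∀ x ∈ Ioo (-R) R, ∀ y ∈ Ioo (-R) R,
    IntervalIntegrable (fun s => singularTerm V₀ (U s)) volume x y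
  equation : ∀ x ∈ Ioo (-R) R, ∀ y ∈ Ioo (-R) R,
    deriv U y - deriv U x = ∫ s in x..y, (singularTerm V₀ (U s) - lam * U s)

/-- A nonnegative solution that is not identically zero on `[-R, R]`. -/
def IsNontrivialNonnegSolution (V₀ R lam : ℝ) (U : ℝ → ℝ) : Prop :=
  IsNonnegSolution V₀ R lam U ∧ ∃ s ∈ Icc (-R) R, U s ≠ 0

/-- The norm of `U` in `L^∞(-R, R)`, for `U` continuous on `[-R, R]`. -/
noncomputable def supNorm (R : ℝ) (U : ℝ → ℝ) : ℝ :=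
  sSup ((fun s => |U s|) '' Icc (-R) R)

/-- The bifurcation diagram: all the pairs `(lam, ‖U‖_∞)` with `U` a nonnegative, not identically
zero, solution for the parameter `lam`. -/
def bifurcationDiagram (V₀ R : ℝ) : Set (ℝ × ℝ) :=
  {p | ∃ U : ℝ → ℝ, IsNontrivialNonnegSolution V₀ R p.1 U ∧ supNorm R U = p.2}

/-- Positive solutions bifurcate from infinity at `lam₀`: there are positive solutions `U n` for
parameters `lam n` with `lam n → lam₀` and `‖U n‖_∞ → ∞`. -/
def IsBifurcationFromInfinity (V₀ R lam₀ : ℝ) : Prop :=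
  ∃ (lam : ℕ → ℝ) (U : ℕ → ℝ → ℝ), (∀ n, IsPositiveSolution V₀ R (lam n) (U n)) ∧
    Tendsto lam atTop (𝓝 lam₀) ∧ Tendsto (fun n => supNorm R (U n)) atTop atTop

/-- `U'(±R) = 0` (one-sided derivatives, from inside `[-R, R]`). -/
def IsFlat (R : ℝ) (U : ℝ → ℝ) : Prop :=
  HasDerivWithinAt U 0 (Icc (-R) R) (-R) ∧ HasDerivWithinAt U 0 (Icc (-R) R) R

end SingularEigenvalue

/-!
The equation is autonomous, and the energy `U'² + lam U² - 4 V₀ √U` is constant wherever `U > 0`.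
Writing a solution with maximum `M` at `s = 0` as `U = M cos θ`, the energy identity becomes
`θ' = √lam √(1 - q k(cos θ))`, where `q = 4 V₀ / (lam M ^ (3/2))` and
`k(t) = (1 - √t) / (1 - t²) = 1 / ((1 + √t) (1 + t))`. This equation is regular also at the maximum,
so it is solved by inverting the time map `θ ↦ ∫₀^θ dφ / √(1 - q k(cos φ))` on
`[-π/2, π/2]`. A nonnegative energy means `q ≤ 1`; the slopes at the ends are `± M √(lam (1 - q))`,
so `q = 1` is the flat case; and the interval of positivity has half-width `G(q) / √lam`, with
`G(q) = ∫₀^{π/2} dφ / √(1 - q k(cos φ))`.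

* `SolvesOn.exists_eq_bump`: every positive solution vanishing at the ends of an interval is such a
  profile. This is uniqueness for the initial value problem at the maximum point.
* `IsNonnegSolution.exists_eq_bump`: for a nonnegative solution the same holds on each component of
  `{U > 0}`, and `q = 1` unless the component is all of `(-R, R)`, since `U' = 0` at interior zeros.
* `strictMonoOn_halfWidth`, `continuousOn_halfWidth`, `exists_hasDerivWithinAt_halfWidth`: `G` is
  continuous and strictly increasing on `[0, 1]`, `G(0) = π / 2`, and `G` has a finite positive left
  derivative at `1`.

Hence a solution for `lam` has `q = min (G⁻¹(R √lam)) 1`, which requires `R √lam > π / 2`, that is,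
`lam > lambdaOne R`; the solution is positive in `(-R, R)` precisely up to
`lam* = (G(1) / R)²`, where `q` reaches `1`; and its norm is `(4 V₀ / (lam q)) ^ (2/3)`. Everything
about the bifurcation curve is read off from this formula. In particular `q` has a positive left
derivative at `lam*` and is constant to the right of it, which produces the corner.

The lower bound for the eigenvalues of the linear problem comes from comparison with a positive
cosine.
-/

namespace SingularEigenvalue


/-! ### The time map -/

/-- The quotient `(1 - √t) / (1 - t²)`, written without the removable singularity at `t = 1`. -/
noncomputable def ratio (t : ℝ) : ℝ := ((1 + √t) * (1 + t))⁻¹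

lemma ratio_pos {t : ℝ} (ht : 0 ≤ t) : 0 < ratio t := by
  unfold ratio; positivity

lemma ratio_le_one {t : ℝ} (ht : 0 ≤ t) : ratio t ≤ 1 := by
  unfold ratio
  apply inv_le_one_of_one_le₀
  nlinarith [Real.sqrt_nonneg t, mul_nonneg (Real.sqrt_nonneg t) ht]

lemma sqrt_div_four_le {t : ℝ} (h0 : 0 ≤ t) (h1 : t ≤ 1) : √t / 4 ≤ 1 - ratio t := by
  have hs := Real.sqrt_nonneg t
  have hs1 : √t ≤ 1 := Real.sqrt_le_one.mpr h1
  have hp : 0 < (1 + √t) * (1 + t) := by positivity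
  have h2 : ratio t * ((1 + √t) * (1 + t)) = 1 := inv_mul_cancel₀ hp.ne'
  have h3 : (1 + √t) * (1 + t) ≤ 4 := by nlinarith
  have h4 : √t ≤ (1 - ratio t) * ((1 + √t) * (1 + t)) := by nlinarith [mul_nonneg hs h0]
  have h5 := sub_nonneg.mpr (ratio_le_one h0)
  nlinarith

lemma continuousOn_ratio : ContinuousOn ratio (Ici 0) := by
  unfold ratio
  refine ContinuousOn.inv₀ (by fun_prop) fun t ht => ?_
  have : (0 : ℝ) ≤ t := ht
  positivity

@[fun_prop]
lemma measurable_ratio : Measurable ratio := by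
  unfold ratio; fun_prop

lemma ratio_arg_le {q t : ℝ} (hq : q ≤ 1) (h0 : 0 ≤ t) (h1 : t ≤ 1) :
    √t / 4 ≤ 1 - q * ratio t := by
  have := sqrt_div_four_le h0 h1
  nlinarith [ratio_pos h0]

lemma ratio_arg_pos {q t : ℝ} (hq : q ≤ 1) (h0 : 0 < t) (h1 : t ≤ 1) :
    0 < 1 - q * ratio t :=
  lt_of_lt_of_le (by positivity) (ratio_arg_le hq h0.le h1)

/-- The bound from which every integral below gets its integrable majorant. -/
lemma inv_mul_sqrt_le {t A : ℝ} (ht : 0 < t) (hA : √t / 4 ≤ A) :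
    (A * √A)⁻¹ ≤ 8 * t ^ (-(3 / 4) : ℝ) := by
  have hs : 0 < √t := Real.sqrt_pos.mpr ht
  have hA0 : 0 ≤ A := le_trans (by positivity) hA
  have h1 : (√t / 4) * √(√t / 4) ≤ A * √A := by gcongr
  have h2 : (√t / 4) * √(√t / 4) = t ^ (3 / 4 : ℝ) / 8 := by
    rw [Real.sqrt_div hs.le, show (4 : ℝ) = 2 ^ 2 by norm_num, Real.sqrt_sq (by norm_num)]
    rw [Real.sqrt_eq_rpow, Real.sqrt_eq_rpow, ← Real.rpow_mul ht.le]
    rw [show (3 / ((2 : ℝ) ^ 2)) = 1 / 2 + 1 / 2 * (1 / 2) by norm_num, Real.rpow_add ht]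
    ring
  have h3 : 0 < t ^ (3 / 4 : ℝ) := by positivity
  rw [Real.rpow_neg ht.le]
  calc (A * √A)⁻¹ ≤ (t ^ (3 / 4 : ℝ) / 8)⁻¹ := by
        rw [h2] at h1; gcongr
    _ = 8 * (t ^ (3 / 4 : ℝ))⁻¹ := by field_simp

/-- The speed `√(1 - q ratio (cos φ))` of the angle `φ` of a solution `M cos φ`. -/
noncomputable def speed (q φ : ℝ) : ℝ := √(1 - q * ratio (Real.cos φ))

open Classical in
/-- The density of the time spent at the angle `φ`. Only the values on `(-π/2, π/2)` matter; the
value `1` elsewhere makes the primitive a homeomorphism of the line. -/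
noncomputable def weight (q φ : ℝ) : ℝ :=
  if φ ∈ Ioo (-(Real.pi / 2)) (Real.pi / 2) then (speed q φ)⁻¹ else 1

lemma weight_of_mem {q φ : ℝ} (h : φ ∈ Ioo (-(Real.pi / 2)) (Real.pi / 2)) :
    weight q φ = (speed q φ)⁻¹ := if_pos h

lemma weight_neg (q φ : ℝ) : weight q (-φ) = weight q φ := by
  have : -φ ∈ Ioo (-(Real.pi / 2)) (Real.pi / 2) ↔ φ ∈ Ioo (-(Real.pi / 2)) (Real.pi / 2) := by
    simp only [mem_Ioo]; constructor <;> intro h <;> constructor <;> linarith [h.1, h.2]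
  simp only [weight, this, speed, Real.cos_neg]

lemma speed_pos {q φ : ℝ} (hq : q ≤ 1) (h : φ ∈ Ioo (-(Real.pi / 2)) (Real.pi / 2)) :
    0 < speed q φ :=
  Real.sqrt_pos.mpr (ratio_arg_pos hq (Real.cos_pos_of_mem_Ioo h) (Real.cos_le_one φ))

lemma one_le_weight {q φ : ℝ} (hq : q ∈ Icc (0 : ℝ) 1) : 1 ≤ weight q φ := by
  by_cases h : φ ∈ Ioo (-(Real.pi / 2)) (Real.pi / 2)
  · rw [weight_of_mem h]
    refine (one_le_inv₀ (speed_pos hq.2 h)).mpr (Real.sqrt_le_one.mpr ?_)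
    have := mul_nonneg hq.1 (ratio_pos (Real.cos_pos_of_mem_Ioo h).le).le
    linarith
  · exact (if_neg h).ge

/-- The majorant of `weight q` for all `q ∈ [0, 1]`. -/
noncomputable def majorant (φ : ℝ) : ℝ :=
  1 + (Ioo (-(Real.pi / 2)) (Real.pi / 2)).indicator
    (fun φ => 8 * Real.cos φ ^ (-(3 / 4) : ℝ)) φ

lemma weight_le_majorant {q φ : ℝ} (hq : q ∈ Icc (0 : ℝ) 1) : weight q φ ≤ majorant φ := by
  by_cases h : φ ∈ Ioo (-(Real.pi / 2)) (Real.pi / 2)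
  · have hc := Real.cos_pos_of_mem_Ioo h
    rw [weight_of_mem h, majorant, indicator_of_mem h]
    have h1 := ratio_arg_le hq.2 hc.le (Real.cos_le_one φ)
    have h2 := inv_mul_sqrt_le hc h1
    have h3 := ratio_arg_pos hq.2 hc (Real.cos_le_one φ)
    have h4 := mul_nonneg hq.1 (ratio_pos hc.le).le
    have h5 : (speed q φ)⁻¹ ≤ ((1 - q * ratio (Real.cos φ)) * √(1 - q * ratio (Real.cos φ)))⁻¹ := by
      have := speed_pos hq.2 h
      unfold speed at *
      gcongr
      nlinarith
    linarith
  · rw [weight, if_neg h, majorant, indicator_of_notMem h, add_zero]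

lemma cos_rpow_le {φ : ℝ} (h : φ ∈ Ioo (-(Real.pi / 2)) (Real.pi / 2)) :
    Real.cos φ ^ (-(3 / 4) : ℝ) ≤
      2 * ((Real.pi / 2 - φ) ^ (-(3 / 4) : ℝ) + (φ - -(Real.pi / 2)) ^ (-(3 / 4) : ℝ)) := by
  have hpi := Real.pi_pos
  have key : ∀ d, 0 < d → d / 2 ≤ Real.cos φ →
      Real.cos φ ^ (-(3 / 4) : ℝ) ≤ 2 * d ^ (-(3 / 4) : ℝ) := by
    intro d hd hdc
    have h1 : Real.cos φ ^ (-(3 / 4) : ℝ) ≤ (d / 2) ^ (-(3 / 4) : ℝ) :=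
      Real.rpow_le_rpow_of_nonpos (by positivity) hdc (by norm_num)
    have h2 : (d / 2) ^ (-(3 / 4) : ℝ) = 2 ^ (3 / 4 : ℝ) * d ^ (-(3 / 4) : ℝ) := by
      rw [Real.div_rpow hd.le (by norm_num), Real.rpow_neg (by norm_num : (0 : ℝ) ≤ 2)]
      field_simp
    have h3 : (2 : ℝ) ^ (3 / 4 : ℝ) ≤ 2 ^ (1 : ℝ) :=
      Real.rpow_le_rpow_of_exponent_le (by norm_num) (by norm_num)
    rw [Real.rpow_one] at h3
    rw [h2] at h1
    exact h1.trans (by gcongr)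
  have h1 : 0 < Real.pi / 2 - φ := by linarith [h.2]
  have h2 : 0 < φ - -(Real.pi / 2) := by linarith [h.1]
  have p1 : 0 < (Real.pi / 2 - φ) ^ (-(3 / 4) : ℝ) := by positivity
  have p2 : 0 < (φ - -(Real.pi / 2)) ^ (-(3 / 4) : ℝ) := by positivity
  -- Jordan's inequality on either half, with `2 / π ≥ 1 / 2`
  have hd : (1 : ℝ) / 2 ≤ 2 / Real.pi := by
    rw [div_le_div_iff₀ (by norm_num) hpi]; linarith [Real.pi_le_four]
  have hpi2 : 2 / Real.pi * (Real.pi / 2) = 1 := by field_simp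
  rcases le_total 0 φ with h0 | h0
  · have := key _ h1 (by
      have := Real.one_sub_mul_le_cos h0 h.2.le
      nlinarith)
    linarith
  · have := key _ h2 (by
      have := Real.one_add_mul_le_cos h.1.le h0
      nlinarith)
    linarith

lemma intervalIntegrable_majorant (a b : ℝ) : IntervalIntegrable majorant volume a b := by
  have h0 : IntegrableOn (fun φ => 8 * Real.cos φ ^ (-(3 / 4) : ℝ))
      (Ioo (-(Real.pi / 2)) (Real.pi / 2)) := by
    have hpi := Real.pi_pos
    have h1 : IntervalIntegrable (fun φ => 8 * (2 * ((Real.pi / 2 - φ) ^ (-(3 / 4) : ℝ) +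
        (φ - -(Real.pi / 2)) ^ (-(3 / 4) : ℝ)))) volume (-(Real.pi / 2)) (Real.pi / 2) := by
      have e : ∀ a b : ℝ, IntervalIntegrable (fun x => x ^ (-(3 / 4) : ℝ)) volume a b :=
        fun a b => intervalIntegral.intervalIntegrable_rpow' (by norm_num)
      have e1 := (e Real.pi 0).comp_sub_left (Real.pi / 2)
      have e2 := (e 0 Real.pi).comp_sub_right (-(Real.pi / 2))
      rw [show Real.pi / 2 - Real.pi = -(Real.pi / 2) by ring, sub_zero] at e1
      rw [show Real.pi + -(Real.pi / 2) = Real.pi / 2 by ring, zero_add] at e2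
      exact ((e1.add e2).const_mul 2).const_mul 8
    have h2 := (intervalIntegrable_iff_integrableOn_Ioo_of_le (by linarith)).mp h1
    refine Integrable.mono' h2 (Measurable.aestronglyMeasurable (by fun_prop)) ?_
    filter_upwards [ae_restrict_mem measurableSet_Ioo] with φ hφ
    have hc := Real.cos_pos_of_mem_Ioo hφ
    rw [Real.norm_of_nonneg (by positivity)]
    have := cos_rpow_le hφ
    linarith
  have h3 := ((integrable_indicator_iff measurableSet_Ioo).mpr h0).intervalIntegrable (a := a)
    (b := b)
  exact (intervalIntegrable_const (c := (1 : ℝ))).add h3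

lemma measurable_speed (q : ℝ) : Measurable (speed q) := by
  unfold speed; fun_prop

lemma measurable_weight (q : ℝ) : Measurable (weight q) :=
  Measurable.ite measurableSet_Ioo (measurable_speed q).inv measurable_const

lemma intervalIntegrable_weight {q : ℝ} (hq : q ∈ Icc (0 : ℝ) 1) (a b : ℝ) :
    IntervalIntegrable (weight q) volume a b := by
  refine (intervalIntegrable_majorant a b).mono_fun (measurable_weight q).aestronglyMeasurable ?_
  refine Eventually.of_forall fun φ => ?_
  have h1 : 1 ≤ weight q φ := one_le_weight hq
  show ‖weight q φ‖ ≤ ‖majorant φ‖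
  rw [Real.norm_of_nonneg (by linarith)]
  exact (weight_le_majorant hq).trans (le_abs_self _)

/-- The rescaled time `√lam s` at which a solution with maximum at `s = 0` reaches the angle
`θ`. -/
noncomputable def timeMap (q θ : ℝ) : ℝ := ∫ φ in (0 : ℝ)..θ, weight q φ

/-- The rescaled half-width `√lam r` of a solution positive on an interval of length `2 r`. -/
noncomputable def halfWidth (q : ℝ) : ℝ := timeMap q (Real.pi / 2)

@[simp] lemma timeMap_zero (q : ℝ) : timeMap q 0 = 0 := by simp [timeMap]

lemma timeMap_neg (q θ : ℝ) : timeMap q (-θ) = -timeMap q θ := by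
  have h := intervalIntegral.integral_comp_neg (a := 0) (b := θ) (weight q)
  simp only [weight_neg, neg_zero] at h
  rw [timeMap, timeMap, h, intervalIntegral.integral_symm]

lemma sub_le_timeMap_sub {q x y : ℝ} (hq : q ∈ Icc (0 : ℝ) 1) (hxy : x ≤ y) :
    y - x ≤ timeMap q y - timeMap q x := by
  have h1 : timeMap q y - timeMap q x = ∫ φ in x..y, weight q φ :=
    intervalIntegral.integral_interval_sub_left (intervalIntegrable_weight hq _ _)
      (intervalIntegrable_weight hq _ _)
  have h2 := intervalIntegral.integral_mono_on hxy (intervalIntegrable_const (c := (1 : ℝ)))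
    (intervalIntegrable_weight hq x y) fun φ _ => one_le_weight hq
  rw [h1]
  simpa using h2

lemma strictMono_timeMap {q : ℝ} (hq : q ∈ Icc (0 : ℝ) 1) : StrictMono (timeMap q) :=
  fun x y hxy => by linarith [sub_le_timeMap_sub hq hxy.le]

lemma continuous_timeMap {q : ℝ} (hq : q ∈ Icc (0 : ℝ) 1) : Continuous (timeMap q) :=
  intervalIntegral.continuous_primitive (fun a b => intervalIntegrable_weight hq a b) 0

lemma surjective_timeMap {q : ℝ} (hq : q ∈ Icc (0 : ℝ) 1) : Function.Surjective (timeMap q) := by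
  refine (continuous_timeMap hq).surjective ?_ ?_
  · refine tendsto_atTop_mono' _ ?_ tendsto_id
    filter_upwards [eventually_ge_atTop 0] with x hx
    simpa using sub_le_timeMap_sub hq hx
  · refine tendsto_atBot_mono' _ ?_ tendsto_id
    filter_upwards [eventually_le_atBot 0] with x hx
    have := sub_le_timeMap_sub hq hx
    simp only [timeMap_zero] at this
    simp only [id]
    linarith

lemma hasDerivAt_timeMap {q θ : ℝ} (hq : q ∈ Icc (0 : ℝ) 1)
    (hθ : θ ∈ Ioo (-(Real.pi / 2)) (Real.pi / 2)) :
    HasDerivAt (timeMap q) (speed q θ)⁻¹ θ := by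
  have hc : ContinuousAt (weight q) θ := by
    have h1 : ContinuousOn (fun φ => (speed q φ)⁻¹) (Ioo (-(Real.pi / 2)) (Real.pi / 2)) := by
      refine ContinuousOn.inv₀ ?_ fun φ hφ => (speed_pos hq.2 hφ).ne'
      refine ContinuousOn.sqrt (continuousOn_const.sub (continuousOn_const.mul ?_))
      exact continuousOn_ratio.comp Real.continuous_cos.continuousOn
        fun φ hφ => (Real.cos_pos_of_mem_Ioo hφ).le
    refine (h1.continuousAt (isOpen_Ioo.mem_nhds hθ)).congr ?_
    filter_upwards [isOpen_Ioo.mem_nhds hθ] with φ hφ using (weight_of_mem hφ).symm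
  rw [← weight_of_mem hθ]
  exact intervalIntegral.integral_hasDerivAt_right (intervalIntegrable_weight hq _ _)
    ((measurable_weight q).stronglyMeasurable.stronglyMeasurableAtFilter) hc

/-! ### Dependence of the half-width on `q` -/

lemma halfWidth_zero : halfWidth 0 = Real.pi / 2 := by
  have : weight 0 = fun _ => 1 := by
    ext φ; simp [weight, speed]
  simp [halfWidth, timeMap, this]

/-- A form free of cancellation; with `A = 1 - ratio t` and `B = 1 - q * ratio t` it gives the slopes
of the integrand of the half-width between `q` and `1`. -/
lemma inv_sqrt_sub_inv_sqrt {A B : ℝ} (hA : 0 < A) (hB : 0 < B) :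
    (√A)⁻¹ - (√B)⁻¹ = (B - A) * (√A * √B * (√A + √B))⁻¹ := by
  have h1 := Real.sqrt_pos.mpr hA
  have h2 := Real.sqrt_pos.mpr hB
  have h3 := Real.sq_sqrt hA.le
  have h4 := Real.sq_sqrt hB.le
  field_simp
  linear_combination h4 - h3

lemma ae_mem_Ioo_of_mem_uIoc :
    ∀ᵐ φ : ℝ, φ ∈ uIoc 0 (Real.pi / 2) → φ ∈ Ioo 0 (Real.pi / 2) := by
  have : ∀ᵐ φ : ℝ, φ ≠ Real.pi / 2 := by simp [ae_iff]
  filter_upwards [this] with φ hφ h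
  rw [uIoc_of_le (by positivity)] at h
  exact ⟨h.1, lt_of_le_of_ne h.2 hφ⟩

lemma Ioo_zero_subset : Ioo 0 (Real.pi / 2) ⊆ Ioo (-(Real.pi / 2)) (Real.pi / 2) :=
  fun _ h => ⟨by linarith [h.1, Real.pi_pos], h.2⟩

lemma strictMonoOn_halfWidth : StrictMonoOn halfWidth (Icc 0 1) := by
  intro p hp q hq hpq
  have h1 : halfWidth q - halfWidth p = ∫ φ in (0 : ℝ)..Real.pi / 2, (weight q φ - weight p φ) :=
    (intervalIntegral.integral_sub (intervalIntegrable_weight hq _ _)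
      (intervalIntegrable_weight hp _ _)).symm
  have h2 := intervalIntegral.intervalIntegral_pos_of_pos_on
    ((intervalIntegrable_weight hq 0 (Real.pi / 2)).sub (intervalIntegrable_weight hp _ _))
    (fun φ hφ => ?_) (by positivity)
  · linarith
  have hφ' := Ioo_zero_subset hφ
  rw [weight_of_mem hφ', weight_of_mem hφ', sub_pos]
  have hs := speed_pos hq.2 hφ'
  have hc := Real.cos_pos_of_mem_Ioo hφ'
  refine inv_strictAnti₀ hs (Real.sqrt_lt_sqrt ?_ ?_)
  · exact (ratio_arg_pos hq.2 hc (Real.cos_le_one φ)).le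
  · have := ratio_pos hc.le
    nlinarith

lemma continuousOn_halfWidth : ContinuousOn halfWidth (Icc 0 1) := by
  intro q hq
  refine intervalIntegral.continuousWithinAt_of_dominated_interval (bound := majorant) ?_ ?_
    (intervalIntegrable_majorant _ _) ?_
  · exact Eventually.of_forall fun p => (measurable_weight p).aestronglyMeasurable
  · filter_upwards [self_mem_nhdsWithin] with p hp
    refine Eventually.of_forall fun φ _ => ?_
    have h1 : 1 ≤ weight p φ := one_le_weight hp
    rw [Real.norm_of_nonneg (by linarith)]
    exact weight_le_majorant hp
  · filter_upwards [ae_mem_Ioo_of_mem_uIoc] with φ hφ h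
    have hφ' := Ioo_zero_subset (hφ h)
    have hs := speed_pos hq.2 hφ'
    simp only [weight_of_mem hφ']
    refine ContinuousWithinAt.inv₀ ?_ hs.ne'
    unfold speed
    fun_prop

/-- The half-width has a finite positive left derivative at `q = 1`, where the boundary slope of
the solution vanishes: the slopes of the integrand are `O(cos φ ^ (-3/4))`, which is integrable. -/
lemma exists_hasDerivWithinAt_halfWidth :
    ∃ g : ℝ, 0 < g ∧ HasDerivWithinAt halfWidth g (Iic 1) 1 := by
  set A : ℝ → ℝ → ℝ := fun q φ => 1 - q * ratio (Real.cos φ) with hAdef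
  -- the slope of the integrand between `q` and `1`
  set F : ℝ → ℝ → ℝ := fun q φ =>
    ratio (Real.cos φ) * (√(A 1 φ) * √(A q φ) * (√(A 1 φ) + √(A q φ)))⁻¹ with hFdef
  have hmeas : ∀ q, Measurable (F q) := fun q => by
    simp only [hFdef, hAdef]; fun_prop
  have hA : ∀ q ≤ 1, ∀ φ ∈ Ioo 0 (Real.pi / 2), 0 < A q φ := fun q hq φ hφ =>
    ratio_arg_pos hq (Real.cos_pos_of_mem_Ioo (Ioo_zero_subset hφ)) (Real.cos_le_one φ)
  have hpos : ∀ q ≤ 1, ∀ φ ∈ Ioo 0 (Real.pi / 2), 0 < F q φ := by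
    intro q hq φ hφ
    have h1 := Real.sqrt_pos.mpr (hA q hq φ hφ)
    have h2 := Real.sqrt_pos.mpr (hA 1 le_rfl φ hφ)
    have h3 := ratio_pos (Real.cos_pos_of_mem_Ioo (Ioo_zero_subset hφ)).le
    simp only [hFdef]
    positivity
  have hbound : ∀ q ≤ 1, ∀ φ ∈ Ioo 0 (Real.pi / 2), F q φ ≤ majorant φ := by
    intro q hq φ hφ
    have hφ' := Ioo_zero_subset hφ
    have hc := Real.cos_pos_of_mem_Ioo hφ'
    have hk := ratio_pos hc.le
    have hk1 := ratio_le_one hc.le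
    have a1 := hA 1 le_rfl φ hφ
    have hle : A 1 φ ≤ A q φ := by simp only [hAdef]; nlinarith
    have hs := Real.sqrt_le_sqrt hle
    have hs1 := Real.sqrt_pos.mpr a1
    have h1 : (√(A 1 φ) * √(A q φ) * (√(A 1 φ) + √(A q φ)))⁻¹ ≤ (A 1 φ * √(A 1 φ))⁻¹ := by
      have e : A 1 φ * √(A 1 φ) = √(A 1 φ) * √(A 1 φ) * √(A 1 φ) := by
        rw [Real.mul_self_sqrt a1.le]
      rw [e]
      gcongr
      linarith
    have h2 := inv_mul_sqrt_le hc (ratio_arg_le le_rfl hc.le (Real.cos_le_one φ) : _ ≤ A 1 φ)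
    rw [majorant, indicator_of_mem hφ']
    have h3 : F q φ ≤ (√(A 1 φ) * √(A q φ) * (√(A 1 φ) + √(A q φ)))⁻¹ :=
      mul_le_of_le_one_left (by positivity) hk1
    linarith
  have hint : IntervalIntegrable (F 1) volume 0 (Real.pi / 2) := by
    refine (intervalIntegrable_majorant _ _).mono_fun (hmeas 1).aestronglyMeasurable ?_
    refine (ae_restrict_iff' measurableSet_uIoc).mpr ?_
    filter_upwards [ae_mem_Ioo_of_mem_uIoc] with φ hφ h
    rw [Real.norm_of_nonneg (hpos 1 le_rfl φ (hφ h)).le]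
    exact (hbound 1 le_rfl φ (hφ h)).trans (le_abs_self _)
  refine ⟨∫ φ in (0 : ℝ)..Real.pi / 2, F 1 φ,
    intervalIntegral.intervalIntegral_pos_of_pos_on hint (hpos 1 le_rfl) (by positivity), ?_⟩
  rw [hasDerivWithinAt_iff_tendsto_slope]
  have hset : Iic (1 : ℝ) \ {1} = Iio 1 := by ext x; simp [lt_iff_le_and_ne]
  rw [hset]
  have hlim : Tendsto (fun q => ∫ φ in (0 : ℝ)..Real.pi / 2, F q φ) (𝓝[<] 1)
      (𝓝 (∫ φ in (0 : ℝ)..Real.pi / 2, F 1 φ)) := by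
    refine intervalIntegral.tendsto_integral_filter_of_dominated_convergence majorant ?_ ?_
      (intervalIntegrable_majorant _ _) ?_
    · exact Eventually.of_forall fun q => (hmeas q).aestronglyMeasurable
    · filter_upwards [self_mem_nhdsWithin] with q hq
      have hq' : q ≤ 1 := le_of_lt hq
      filter_upwards [ae_mem_Ioo_of_mem_uIoc] with φ hφ h
      rw [Real.norm_of_nonneg (hpos q hq' φ (hφ h)).le]
      exact hbound q hq' φ (hφ h)
    · filter_upwards [ae_mem_Ioo_of_mem_uIoc] with φ hφ h
      have a1 := Real.sqrt_pos.mpr (hA 1 le_rfl φ (hφ h))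
      have : ContinuousAt (fun q => F q φ) 1 := by
        simp only [hFdef]
        refine ContinuousAt.mul continuousAt_const (ContinuousAt.inv₀ ?_ (by positivity))
        simp only [hAdef]
        fun_prop
      exact this.tendsto.mono_left nhdsWithin_le_nhds
  refine hlim.congr' ?_
  have hnear : Ioo (0 : ℝ) 1 ∈ 𝓝[<] (1 : ℝ) := Ioo_mem_nhdsLT (by norm_num)
  filter_upwards [hnear] with q hq
  have hq' : q ∈ Icc (0 : ℝ) 1 := ⟨hq.1.le, hq.2.le⟩
  have h1' : (1 : ℝ) ∈ Icc (0 : ℝ) 1 := by simp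
  have h1 : halfWidth 1 - halfWidth q = ∫ φ in (0 : ℝ)..Real.pi / 2, (weight 1 φ - weight q φ) :=
    (intervalIntegral.integral_sub (intervalIntegrable_weight h1' _ _)
      (intervalIntegrable_weight hq' _ _)).symm
  have h2 : (∫ φ in (0 : ℝ)..Real.pi / 2, (weight 1 φ - weight q φ)) =
      ∫ φ in (0 : ℝ)..Real.pi / 2, (1 - q) * F q φ := by
    refine intervalIntegral.integral_congr_ae ?_
    filter_upwards [ae_mem_Ioo_of_mem_uIoc] with φ hφ h
    have hφ' := Ioo_zero_subset (hφ h)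
    rw [weight_of_mem hφ', weight_of_mem hφ']
    have := inv_sqrt_sub_inv_sqrt (hA 1 le_rfl φ (hφ h)) (hA q hq.2.le φ (hφ h))
    simp only [speed, hFdef]
    refine this.trans ?_
    simp only [hAdef]
    ring
  rw [slope_comm, slope_def_field, h1, h2, intervalIntegral.integral_const_mul]
  have : (1 : ℝ) - q ≠ 0 := by linarith [hq.2]
  field_simp


/-! ### The solution with a prescribed maximum -/

/-- The inverse of `timeMap q`. -/
noncomputable def angle (q : ℝ) : ℝ → ℝ := Function.invFun (timeMap q)

section angle

variable {q : ℝ}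

lemma timeMap_angle (hq : q ∈ Icc (0 : ℝ) 1) (s : ℝ) : timeMap q (angle q s) = s :=
  Function.rightInverse_invFun (surjective_timeMap hq) s

lemma angle_timeMap (hq : q ∈ Icc (0 : ℝ) 1) (θ : ℝ) : angle q (timeMap q θ) = θ :=
  Function.leftInverse_invFun (strictMono_timeMap hq).injective θ

lemma strictMono_angle (hq : q ∈ Icc (0 : ℝ) 1) : StrictMono (angle q) := fun x y hxy => by
  rw [← (strictMono_timeMap hq).lt_iff_lt, timeMap_angle hq, timeMap_angle hq]
  exact hxy

lemma continuous_angle (hq : q ∈ Icc (0 : ℝ) 1) : Continuous (angle q) :=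
  (strictMono_angle hq).monotone.continuous_of_surjective
    fun θ => ⟨timeMap q θ, angle_timeMap hq θ⟩

lemma angle_zero (hq : q ∈ Icc (0 : ℝ) 1) : angle q 0 = 0 := by
  simpa using angle_timeMap hq 0

lemma angle_halfWidth (hq : q ∈ Icc (0 : ℝ) 1) : angle q (halfWidth q) = Real.pi / 2 :=
  angle_timeMap hq _

lemma angle_neg_halfWidth (hq : q ∈ Icc (0 : ℝ) 1) : angle q (-halfWidth q) = -(Real.pi / 2) := by
  rw [halfWidth, ← timeMap_neg, angle_timeMap hq]

lemma halfWidth_pos (hq : q ∈ Icc (0 : ℝ) 1) : 0 < halfWidth q := by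
  have h := strictMono_timeMap hq (show (0 : ℝ) < Real.pi / 2 by positivity)
  rwa [timeMap_zero] at h

lemma angle_mem_Ioo (hq : q ∈ Icc (0 : ℝ) 1) {s : ℝ} (hs : s ∈ Ioo (-halfWidth q) (halfWidth q)) :
    angle q s ∈ Ioo (-(Real.pi / 2)) (Real.pi / 2) := by
  rw [← angle_neg_halfWidth hq, ← angle_halfWidth hq]
  exact ⟨strictMono_angle hq hs.1, strictMono_angle hq hs.2⟩

lemma angle_mem_Icc (hq : q ∈ Icc (0 : ℝ) 1) {s : ℝ} (hs : s ∈ Icc (-halfWidth q) (halfWidth q)) :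
    angle q s ∈ Icc (-(Real.pi / 2)) (Real.pi / 2) := by
  rw [← angle_neg_halfWidth hq, ← angle_halfWidth hq]
  exact ⟨(strictMono_angle hq).monotone hs.1, (strictMono_angle hq).monotone hs.2⟩

lemma hasDerivAt_angle (hq : q ∈ Icc (0 : ℝ) 1) {s : ℝ}
    (hs : s ∈ Ioo (-halfWidth q) (halfWidth q)) :
    HasDerivAt (angle q) (speed q (angle q s)) s := by
  have h1 := angle_mem_Ioo hq hs
  have h2 := HasDerivAt.of_local_left_inverse (continuous_angle hq).continuousAt
    (hasDerivAt_timeMap hq h1) (inv_ne_zero (speed_pos hq.2 h1).ne')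
    (Eventually.of_forall (timeMap_angle hq))
  rwa [inv_inv] at h2

/-- The derivative of `cos (angle q s)`. -/
noncomputable def profileSlope (q s : ℝ) : ℝ := -(Real.sin (angle q s) * speed q (angle q s))

lemma hasDerivAt_profile (hq : q ∈ Icc (0 : ℝ) 1) {s : ℝ}
    (hs : s ∈ Ioo (-halfWidth q) (halfWidth q)) :
    HasDerivAt (fun s => Real.cos (angle q s)) (profileSlope q s) s := by
  have := (hasDerivAt_angle hq hs).cos
  rwa [neg_mul] at this

lemma hasDerivAt_ratio {t : ℝ} (ht : 0 < t) :
    ∃ k', HasDerivAt ratio k' t ∧ k' * (1 - t ^ 2) = 2 * t * ratio t - 1 / (2 * √t) := by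
  have hs := Real.sqrt_pos.mpr ht
  have h0 : (1 + √t) * (1 + t) ≠ 0 := by positivity
  have h1 := (((Real.hasDerivAt_sqrt ht.ne').const_add 1).mul ((hasDerivAt_id t).const_add 1)).inv
    (by simpa using h0)
  refine ⟨_, h1, ?_⟩
  have h2 := Real.sq_sqrt ht.le
  simp only [ratio, id, Pi.mul_apply]
  generalize √t = u at *
  subst h2
  field_simp
  ring

lemma hasDerivAt_profileSlope (hq : q ∈ Icc (0 : ℝ) 1) {s : ℝ}
    (hs : s ∈ Ioo (-halfWidth q) (halfWidth q)) :
    HasDerivAt (profileSlope q)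
      (q / (4 * √(Real.cos (angle q s))) - Real.cos (angle q s)) s := by
  have hθ := angle_mem_Ioo hq hs
  have hc := Real.cos_pos_of_mem_Ioo hθ
  have hA := ratio_arg_pos hq.2 hc (Real.cos_le_one _)
  have hS := speed_pos hq.2 hθ
  obtain ⟨k', hk, hk'⟩ := hasDerivAt_ratio hc
  have hdθ := hasDerivAt_angle hq hs
  have hd1 := hasDerivAt_profile hq hs
  have hd2 := (((hk.comp s hd1).const_mul q).const_sub 1).sqrt (by exact hA.ne')
  have hd3 := (hdθ.sin.mul hd2).neg
  refine hd3.congr_deriv ?_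
  simp only [profileSlope, Function.comp_apply]
  have hS2 : speed q (angle q s) ^ 2 = 1 - q * ratio (Real.cos (angle q s)) := Real.sq_sqrt hA.le
  have hsc := Real.sin_sq_add_cos_sq (angle q s)
  change -(Real.cos (angle q s) * speed q (angle q s) * speed q (angle q s) +
    Real.sin (angle q s) * (-(q * (k' * -(Real.sin (angle q s) * speed q (angle q s)))) /
      (2 * speed q (angle q s)))) = _
  have e : Real.sin (angle q s) * (-(q * (k' * -(Real.sin (angle q s) * speed q (angle q s)))) /
      (2 * speed q (angle q s))) = q * k' * Real.sin (angle q s) ^ 2 / 2 := by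
    field_simp
  rw [e, show Real.sin (angle q s) ^ 2 = 1 - Real.cos (angle q s) ^ 2 by linarith]
  have e2 : q / (4 * √(Real.cos (angle q s))) = q / 2 * (1 / (2 * √(Real.cos (angle q s)))) := by
    have := Real.sqrt_pos.mpr hc
    field_simp
    norm_num
  rw [e2]
  linear_combination (-Real.cos (angle q s)) * hS2 - q / 2 * hk'

lemma continuousOn_profileSlope (hq : q ∈ Icc (0 : ℝ) 1) :
    ContinuousOn (profileSlope q) (Icc (-halfWidth q) (halfWidth q)) := by
  have h1 := continuous_angle hq
  refine ((Real.continuous_sin.comp h1).continuousOn.mul ?_).neg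
  refine ContinuousOn.sqrt (continuousOn_const.sub (continuousOn_const.mul ?_))
  exact continuousOn_ratio.comp (Real.continuous_cos.comp h1).continuousOn
    fun s hs => Real.cos_nonneg_of_mem_Icc (angle_mem_Icc hq hs)

lemma profileSlope_halfWidth (hq : q ∈ Icc (0 : ℝ) 1) :
    profileSlope q (halfWidth q) = -√(1 - q) := by
  simp [profileSlope, angle_halfWidth hq, speed, ratio]

lemma profileSlope_neg_halfWidth (hq : q ∈ Icc (0 : ℝ) 1) :
    profileSlope q (-halfWidth q) = √(1 - q) := by
  simp [profileSlope, angle_neg_halfWidth hq, speed, ratio]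

end angle

/-- `U` is a positive classical solution of the equation in `(a, b)`, with no boundary condition. -/
def SolvesOn (V₀ lam : ℝ) (U : ℝ → ℝ) (a b : ℝ) : Prop :=
  ∀ s ∈ Ioo a b, 0 < U s ∧ DifferentiableAt ℝ U s ∧
    HasDerivAt (deriv U) (V₀ / √(U s) - lam * U s) s

/-- The candidate solution with parameter `lam`, centred at `0` and with maximum `M`; it solves the
equation if `lam * q * M ^ (3/2) = 4 V₀`. Only the values for `|√lam s| ≤ halfWidth q` matter. -/
noncomputable def bump (lam M q s : ℝ) : ℝ := M * Real.cos (angle q (√lam * s))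

/-- The half-width of the interval on which `bump lam M q` is positive. -/
noncomputable def bumpRadius (lam q : ℝ) : ℝ := halfWidth q / √lam

section bump

variable {V₀ lam M q : ℝ}

lemma mul_mem_Ioo (hlam : 0 < lam) {s : ℝ} (hs : s ∈ Ioo (-bumpRadius lam q) (bumpRadius lam q)) :
    √lam * s ∈ Ioo (-halfWidth q) (halfWidth q) := by
  have hl := Real.sqrt_pos.mpr hlam
  unfold bumpRadius at hs
  rw [← neg_div] at hs
  constructor
  · have := (div_lt_iff₀ hl).mp hs.1; linarith
  · have := (lt_div_iff₀ hl).mp hs.2; linarith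

lemma mul_mem_Icc (hlam : 0 < lam) {s : ℝ} (hs : s ∈ Icc (-bumpRadius lam q) (bumpRadius lam q)) :
    √lam * s ∈ Icc (-halfWidth q) (halfWidth q) := by
  have hl := Real.sqrt_pos.mpr hlam
  unfold bumpRadius at hs
  rw [← neg_div] at hs
  constructor
  · have := (div_le_iff₀ hl).mp hs.1; linarith
  · have := (le_div_iff₀ hl).mp hs.2; linarith

lemma sqrt_mul_bumpRadius (hlam : 0 < lam) : √lam * bumpRadius lam q = halfWidth q := by
  have hl := Real.sqrt_pos.mpr hlam
  unfold bumpRadius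
  field_simp

lemma bumpRadius_pos (hlam : 0 < lam) (hq : q ∈ Icc (0 : ℝ) 1) : 0 < bumpRadius lam q :=
  div_pos (halfWidth_pos hq) (Real.sqrt_pos.mpr hlam)

lemma continuous_bump (hq : q ∈ Icc (0 : ℝ) 1) : Continuous (bump lam M q) := by
  have := continuous_angle hq
  unfold bump
  fun_prop

lemma bump_zero (hq : q ∈ Icc (0 : ℝ) 1) : bump lam M q 0 = M := by
  simp [bump, angle_zero hq]

lemma bump_le (hM : 0 ≤ M) (s : ℝ) : bump lam M q s ≤ M :=
  mul_le_of_le_one_right hM (Real.cos_le_one _)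

lemma bump_radius (hlam : 0 < lam) (hq : q ∈ Icc (0 : ℝ) 1) :
    bump lam M q (bumpRadius lam q) = 0 := by
  simp [bump, sqrt_mul_bumpRadius hlam, angle_halfWidth hq]

lemma bump_neg_radius (hlam : 0 < lam) (hq : q ∈ Icc (0 : ℝ) 1) :
    bump lam M q (-bumpRadius lam q) = 0 := by
  simp [bump, sqrt_mul_bumpRadius hlam, angle_neg_halfWidth hq]

lemma bump_pos (hlam : 0 < lam) (hM : 0 < M) (hq : q ∈ Icc (0 : ℝ) 1) {s : ℝ}
    (hs : s ∈ Ioo (-bumpRadius lam q) (bumpRadius lam q)) : 0 < bump lam M q s :=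
  mul_pos hM (Real.cos_pos_of_mem_Ioo (angle_mem_Ioo hq (mul_mem_Ioo hlam hs)))

lemma hasDerivAt_bump (hlam : 0 < lam) (hq : q ∈ Icc (0 : ℝ) 1) {s : ℝ}
    (hs : s ∈ Ioo (-bumpRadius lam q) (bumpRadius lam q)) :
    HasDerivAt (bump lam M q) (M * √lam * profileSlope q (√lam * s)) s := by
  have h := ((hasDerivAt_profile hq (mul_mem_Ioo hlam hs)).comp s
    ((hasDerivAt_id s).const_mul √lam)).const_mul M
  exact h.congr_deriv (by ring)

lemma deriv_bump_eventuallyEq (hlam : 0 < lam) (hq : q ∈ Icc (0 : ℝ) 1) {s : ℝ}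
    (hs : s ∈ Ioo (-bumpRadius lam q) (bumpRadius lam q)) :
    deriv (bump lam M q) =ᶠ[𝓝 s] fun s => M * √lam * profileSlope q (√lam * s) := by
  filter_upwards [isOpen_Ioo.mem_nhds hs] with x hx using (hasDerivAt_bump hlam hq hx).deriv

lemma solvesOn_bump (hlam : 0 < lam) (hM : 0 < M) (hq : q ∈ Icc (0 : ℝ) 1)
    (h : lam * q * (M * √M) = 4 * V₀) :
    SolvesOn V₀ lam (bump lam M q) (-bumpRadius lam q) (bumpRadius lam q) := by
  intro s hs
  have hs' := mul_mem_Ioo hlam hs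
  have hc := Real.cos_pos_of_mem_Ioo (angle_mem_Ioo hq hs')
  refine ⟨bump_pos hlam hM hq hs, (hasDerivAt_bump hlam hq hs).differentiableAt, ?_⟩
  have hd := ((hasDerivAt_profileSlope hq hs').comp s
    ((hasDerivAt_id s).const_mul √lam)).const_mul (M * √lam)
  refine HasDerivAt.congr_of_eventuallyEq ?_ (deriv_bump_eventuallyEq hlam hq hs)
  refine hd.congr_deriv ?_
  have h1 := Real.sqrt_pos.mpr hc
  have h2 := Real.sqrt_pos.mpr hM
  have h3 := Real.mul_self_sqrt hlam.le
  simp only [bump, Real.sqrt_mul hM.le]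
  generalize √(Real.cos (angle q (√lam * s))) = u at *
  generalize Real.cos (angle q (√lam * s)) = c at *
  have e : V₀ / (√M * u) = lam * M * (q / (4 * u)) := by
    rw [div_eq_iff (by positivity)]
    field_simp
    linarith
  rw [e]
  linear_combination (M * (q / (4 * u) - c)) * h3

lemma tendsto_deriv_bump_right (hlam : 0 < lam) (hq : q ∈ Icc (0 : ℝ) 1) :
    Tendsto (deriv (bump lam M q)) (𝓝[<] (bumpRadius lam q)) (𝓝 (-(M * √lam * √(1 - q)))) := by
  have hr := bumpRadius_pos hlam hq
  have hI : Ioo (-bumpRadius lam q) (bumpRadius lam q) ∈ 𝓝[<] (bumpRadius lam q) :=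
    Ioo_mem_nhdsLT (by linarith)
  have h1 : ContinuousOn (fun s => M * √lam * profileSlope q (√lam * s))
      (Icc (-bumpRadius lam q) (bumpRadius lam q)) :=
    continuousOn_const.mul ((continuousOn_profileSlope hq).comp (by fun_prop)
      fun s hs => mul_mem_Icc hlam hs)
  have h2 := h1 (bumpRadius lam q) ⟨by linarith, le_rfl⟩
  have h3 : Tendsto _ (𝓝[<] (bumpRadius lam q)) _ :=
    h2.tendsto.mono_left (nhdsWithin_le_iff.mpr (mem_of_superset hI Ioo_subset_Icc_self))
  rw [sqrt_mul_bumpRadius hlam, profileSlope_halfWidth hq, mul_neg] at h3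
  refine h3.congr' ?_
  filter_upwards [hI] with x hx using (hasDerivAt_bump hlam hq hx).deriv.symm

lemma tendsto_deriv_bump_left (hlam : 0 < lam) (hq : q ∈ Icc (0 : ℝ) 1) :
    Tendsto (deriv (bump lam M q)) (𝓝[>] (-bumpRadius lam q)) (𝓝 (M * √lam * √(1 - q))) := by
  have hr := bumpRadius_pos hlam hq
  have hI : Ioo (-bumpRadius lam q) (bumpRadius lam q) ∈ 𝓝[>] (-bumpRadius lam q) :=
    Ioo_mem_nhdsGT (by linarith)
  have h1 : ContinuousOn (fun s => M * √lam * profileSlope q (√lam * s))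
      (Icc (-bumpRadius lam q) (bumpRadius lam q)) :=
    continuousOn_const.mul ((continuousOn_profileSlope hq).comp (by fun_prop)
      fun s hs => mul_mem_Icc hlam hs)
  have h2 := h1 (-bumpRadius lam q) ⟨le_rfl, by linarith⟩
  have h3 : Tendsto _ (𝓝[>] (-bumpRadius lam q)) _ :=
    h2.tendsto.mono_left (nhdsWithin_le_iff.mpr (mem_of_superset hI Ioo_subset_Icc_self))
  rw [mul_neg, sqrt_mul_bumpRadius hlam, profileSlope_neg_halfWidth hq] at h3
  refine h3.congr' ?_
  filter_upwards [hI] with x hx using (hasDerivAt_bump hlam hq hx).deriv.symm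

/-- One-sided derivatives of the solution at the ends of its interval. -/
lemma hasDerivWithinAt_bump_right (hlam : 0 < lam) (hq : q ∈ Icc (0 : ℝ) 1) :
    HasDerivWithinAt (bump lam M q) (-(M * √lam * √(1 - q))) (Iic (bumpRadius lam q))
      (bumpRadius lam q) :=
  hasDerivWithinAt_Iic_of_tendsto_deriv
    (fun _ hs => (hasDerivAt_bump hlam hq hs).differentiableAt.differentiableWithinAt)
    (continuous_bump hq).continuousWithinAt
    (Ioo_mem_nhdsLT (by linarith [bumpRadius_pos hlam hq])) (tendsto_deriv_bump_right hlam hq)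

lemma hasDerivWithinAt_bump_left (hlam : 0 < lam) (hq : q ∈ Icc (0 : ℝ) 1) :
    HasDerivWithinAt (bump lam M q) (M * √lam * √(1 - q)) (Ici (-bumpRadius lam q))
      (-bumpRadius lam q) :=
  hasDerivWithinAt_Ici_of_tendsto_deriv
    (fun _ hs => (hasDerivAt_bump hlam hq hs).differentiableAt.differentiableWithinAt)
    (continuous_bump hq).continuousWithinAt
    (Ioo_mem_nhdsGT (by linarith [bumpRadius_pos hlam hq])) (tendsto_deriv_bump_left hlam hq)

end bump


/-! ### Classification of the solutions vanishing at the ends of an interval -/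

section classification

variable {V₀ lam a b : ℝ} {U W : ℝ → ℝ}

lemma SolvesOn.mono {a' b' : ℝ} (h : SolvesOn V₀ lam U a b) (ha : a ≤ a') (hb : b' ≤ b) :
    SolvesOn V₀ lam U a' b' :=
  fun s hs => h s ⟨ha.trans_lt hs.1, hs.2.trans_le hb⟩

lemma SolvesOn.comp_sub (h : SolvesOn V₀ lam U a b) (c : ℝ) :
    SolvesOn V₀ lam (fun s => U (s - c)) (a + c) (b + c) := by
  intro s hs
  obtain ⟨h1, h2, h3⟩ := h (s - c) ⟨by linarith [hs.1], by linarith [hs.2]⟩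
  have e : deriv (fun s => U (s - c)) = fun s => deriv U (s - c) := by
    ext x; exact deriv_comp_sub_const U c x
  refine ⟨h1, (h2.hasDerivAt.comp_sub_const s c).differentiableAt, ?_⟩
  rw [e]
  exact h3.comp_sub_const s c

/-- Uniqueness for the initial value problem, as long as the solutions are positive. -/
lemma SolvesOn.eqOn_Ioo (hU : SolvesOn V₀ lam U a b) (hW : SolvesOn V₀ lam W a b) {t : ℝ}
    (ht : t ∈ Ioo a b) (h0 : U t = W t) (h1 : deriv U t = deriv W t) : EqOn U W (Ioo a b) := by
  intro s hs
  obtain ⟨c, hc1, hc2⟩ : ∃ c, a < c ∧ c < min s t := exists_between (lt_min hs.1 ht.1)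
  obtain ⟨d, hd1, hd2⟩ : ∃ d, max s t < d ∧ d < b := exists_between (max_lt hs.2 ht.2)
  have hcs := hc2.trans_le (min_le_left _ _)
  have hct := hc2.trans_le (min_le_right _ _)
  have hds := (le_max_left _ _).trans_lt hd1
  have hdt := (le_max_right _ _).trans_lt hd1
  have hsub : Icc c d ⊆ Ioo a b := fun x hx => ⟨hc1.trans_le hx.1, hx.2.trans_lt hd2⟩
  have hne : (Icc c d).Nonempty := ⟨s, hcs.le, hds.le⟩
  have cU : ContinuousOn U (Icc c d) := fun x hx =>
    (hU x (hsub hx)).2.1.continuousAt.continuousWithinAt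
  have cW : ContinuousOn W (Icc c d) := fun x hx =>
    (hW x (hsub hx)).2.1.continuousAt.continuousWithinAt
  -- on `[c, d]` both solutions stay in a compact interval on which the equation is Lipschitz
  obtain ⟨x1, hx1, m1⟩ := isCompact_Icc.exists_isMinOn hne cU
  obtain ⟨x2, hx2, m2⟩ := isCompact_Icc.exists_isMinOn hne cW
  obtain ⟨x3, hx3, m3⟩ := isCompact_Icc.exists_isMaxOn hne cU
  obtain ⟨x4, hx4, m4⟩ := isCompact_Icc.exists_isMaxOn hne cW
  set ε := min (U x1) (W x2)
  set K := max (U x3) (W x4)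
  have hε : 0 < ε := lt_min (hU x1 (hsub hx1)).1 (hW x2 (hsub hx2)).1
  have mU : ∀ x ∈ Icc c d, U x ∈ Icc ε K := fun x hx =>
    ⟨(min_le_left _ _).trans (m1 hx), (m3 hx).trans (le_max_left _ _)⟩
  have mW : ∀ x ∈ Icc c d, W x ∈ Icc ε K := fun x hx =>
    ⟨(min_le_right _ _).trans (m2 hx), (m4 hx).trans (le_max_right _ _)⟩
  have hF : ContDiffOn ℝ 1 (fun u : ℝ => V₀ / √u - lam * u) (Icc ε K) := by
    refine ContDiffOn.sub (contDiffOn_const.div ?_ ?_) (by fun_prop)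
    · exact contDiffOn_id.sqrt fun x hx => (hε.trans_le hx.1).ne'
    · exact fun x hx => (Real.sqrt_pos.mpr (hε.trans_le hx.1)).ne'
  obtain ⟨L, hL⟩ := hF.exists_lipschitzOnWith (by norm_num) (convex_Icc ε K) isCompact_Icc
  have hv : LipschitzOnWith (max 1 L) (fun p : ℝ × ℝ => (p.2, V₀ / √p.1 - lam * p.1))
      {p | p.1 ∈ Icc ε K} := by
    refine LipschitzOnWith.prodMk LipschitzWith.prod_snd.lipschitzOnWith ?_
    have := hL.comp (LipschitzWith.prod_fst (α := ℝ) (β := ℝ)).lipschitzOnWith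
      (s := {p : ℝ × ℝ | p.1 ∈ Icc ε K}) (fun p hp => hp)
    rwa [mul_one] at this
  have key : EqOn (fun x => (U x, deriv U x)) (fun x => (W x, deriv W x)) (Ioo c d) := by
    refine ODE_solution_unique_of_mem_Ioo
      (v := fun _ p => (p.2, V₀ / √p.1 - lam * p.1)) (s := fun _ => {p | p.1 ∈ Icc ε K})
      (fun _ _ => hv) ⟨hct, hdt⟩ ?_ ?_ (by simp [h0, h1])
    · intro x hx
      obtain ⟨_, d1, d2⟩ := hU x (hsub (Ioo_subset_Icc_self hx))
      exact ⟨d1.hasDerivAt.prodMk d2, mU x (Ioo_subset_Icc_self hx)⟩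
    · intro x hx
      obtain ⟨_, d1, d2⟩ := hW x (hsub (Ioo_subset_Icc_self hx))
      exact ⟨d1.hasDerivAt.prodMk d2, mW x (Ioo_subset_Icc_self hx)⟩
  exact congrArg Prod.fst (key ⟨hcs, hds⟩)

/-- Conservation of the energy `U'² + lam U² - 4 V₀ √U`. -/
lemma SolvesOn.energy_eq (h : SolvesOn V₀ lam U a b) {s t : ℝ} (hs : s ∈ Ioo a b)
    (ht : t ∈ Ioo a b) :
    deriv U s ^ 2 + lam * U s ^ 2 - 4 * V₀ * √(U s) =
      deriv U t ^ 2 + lam * U t ^ 2 - 4 * V₀ * √(U t) := by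
  have hd : ∀ x ∈ Ioo a b,
      HasDerivAt (fun x => deriv U x ^ 2 + lam * U x ^ 2 - 4 * V₀ * √(U x)) 0 x := by
    intro x hx
    obtain ⟨h1, h2, h3⟩ := h x hx
    have h4 := (((h3.pow 2).add ((h2.hasDerivAt.pow 2).const_mul lam)).sub
      ((h2.hasDerivAt.sqrt h1.ne').const_mul (4 * V₀)))
    refine h4.congr_deriv ?_
    have := Real.sqrt_pos.mpr h1
    field_simp
    ring
  exact isOpen_Ioo.is_const_of_deriv_eq_zero isPreconnected_Ioo
    (fun x hx => (hd x hx).differentiableAt.differentiableWithinAt)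
    (fun x hx => (hd x hx).deriv) hs ht

/-- A positive solution on `(a, b)` vanishing at `a` and `b` is a translate of a `bump`. -/
theorem SolvesOn.exists_eq_bump (hV : 0 < V₀) (hab : a < b) (h : SolvesOn V₀ lam U a b)
    (hc : ContinuousOn U (Icc a b)) (ha : U a = 0) (hb : U b = 0) :
    ∃ M q, 0 < lam ∧ 0 < M ∧ q ∈ Ioc (0 : ℝ) 1 ∧ lam * q * (M * √M) = 4 * V₀ ∧
      b - a = 2 * bumpRadius lam q ∧
      EqOn U (fun s => bump lam M q (s - (a + b) / 2)) (Icc a b) := by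
  obtain ⟨s₀, hs₀, hmax⟩ := isCompact_Icc.exists_isMaxOn ⟨a, le_rfl, hab.le⟩ hc
  have hM : 0 < U s₀ := by
    have hm : (a + b) / 2 ∈ Ioo a b := ⟨by linarith, by linarith⟩
    exact (h _ hm).1.trans_le (hmax (Ioo_subset_Icc_self hm))
  have hs : s₀ ∈ Ioo a b := by
    refine ⟨lt_of_le_of_ne hs₀.1 ?_, lt_of_le_of_ne hs₀.2 ?_⟩
    · rintro rfl; linarith
    · rintro rfl; linarith
  have hd0 : deriv U s₀ = 0 := by
    have : IsLocalMax U s₀ := hmax.isLocalMax (Icc_mem_nhds hs.1 hs.2)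
    exact this.deriv_eq_zero
  -- letting `s → a` in the energy identity shows that the energy is nonnegative
  have hE : 0 ≤ lam * U s₀ ^ 2 - 4 * V₀ * √(U s₀) := by
    have hca : Tendsto U (𝓝[>] a) (𝓝 (U a)) := by
      have : ContinuousWithinAt U (Icc a b) a := hc a ⟨le_rfl, hab.le⟩
      exact this.tendsto.mono_left (nhdsWithin_le_iff.mpr
        (mem_of_superset (Ioo_mem_nhdsGT hab) Ioo_subset_Icc_self))
    rw [ha] at hca
    have hlim : Tendsto (fun s => lam * U s ^ 2 - 4 * V₀ * √(U s)) (𝓝[>] a)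
        (𝓝 (lam * 0 ^ 2 - 4 * V₀ * √0)) :=
      ((hca.pow 2).const_mul lam).sub (hca.sqrt.const_mul (4 * V₀))
    rw [Real.sqrt_zero] at hlim
    norm_num at hlim
    refine le_of_tendsto hlim ?_
    filter_upwards [Ioo_mem_nhdsGT hab] with s hs'
    have := h.energy_eq hs' hs
    rw [hd0] at this
    nlinarith [sq_nonneg (deriv U s)]
  set M := U s₀ with hMdef
  have hsM := Real.sqrt_pos.mpr hM
  have hsq := Real.mul_self_sqrt hM.le
  have hE' : 4 * V₀ ≤ lam * (M * √M) := by
    have e : lam * M ^ 2 - 4 * V₀ * √M = √M * (lam * (M * √M) - 4 * V₀) := by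
      linear_combination (-lam * M) * hsq
    rw [e] at hE
    have := nonneg_of_mul_nonneg_right hE hsM
    linarith
  have hMM : 0 < M * √M := mul_pos hM hsM
  have hlam : 0 < lam := pos_of_mul_pos_left (by linarith : 0 < lam * (M * √M)) hMM.le
  set q := 4 * V₀ / (lam * (M * √M)) with hqdef
  have hq0 : 0 < q := by positivity
  have hq1 : q ≤ 1 := (div_le_one (by positivity)).mpr hE'
  have hq : q ∈ Icc (0 : ℝ) 1 := ⟨hq0.le, hq1⟩
  have hrel : lam * q * (M * √M) = 4 * V₀ := by
    rw [hqdef]; field_simp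
  set r := bumpRadius lam q with hr
  have hrpos : 0 < r := bumpRadius_pos hlam hq
  have hB0 := (solvesOn_bump hlam hM hq hrel).comp_sub s₀
  set B : ℝ → ℝ := fun s => bump lam M q (s - s₀) with hBdef
  have hBc : Continuous B := (continuous_bump hq).comp (by fun_prop)
  set l := max a (-r + s₀) with hl
  set m := min b (r + s₀) with hm
  have hl' : l < s₀ := max_lt hs.1 (by linarith)
  have hm' : s₀ < m := lt_min hs.2 (by linarith)
  have hBd : deriv B s₀ = 0 := by
    have : IsLocalMax B s₀ := Eventually.of_forall fun s => by
      simp only [hBdef, sub_self, bump_zero hq]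
      exact bump_le hM.le _
    exact this.deriv_eq_zero
  have heq : EqOn U B (Ioo l m) :=
    (h.mono (le_max_left _ _) (min_le_left _ _)).eqOn_Ioo
      (hB0.mono (le_max_right _ _) (min_le_right _ _)) ⟨hl', hm'⟩
      (by simp only [hBdef, sub_self, bump_zero hq]; rfl) (by rw [hd0, hBd])
  have heq' : EqOn U B (Icc l m) := by
    refine heq.of_subset_closure (hc.mono (Icc_subset_Icc (le_max_left _ _) (min_le_left _ _)))
      hBc.continuousOn Ioo_subset_Icc_self ?_
    rw [closure_Ioo (by linarith)]
  have hlm : l ≤ m := by linarith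
  have hBpos : ∀ s ∈ Ioo (-r + s₀) (r + s₀), 0 < B s := fun s hs' => (hB0 s hs').1
  have hb' : b = r + s₀ := by
    have hv : U m = B m := heq' ⟨hlm, le_rfl⟩
    rcases lt_trichotomy b (r + s₀) with h1 | h1 | h1
    · rw [hm, min_eq_left h1.le, hb] at hv
      have := hBpos b ⟨by linarith [hs.2], h1⟩
      linarith
    · exact h1
    · rw [hm, min_eq_right h1.le] at hv
      have h2 := (h (r + s₀) ⟨by linarith [hs.1], h1⟩).1
      have h3 : B (r + s₀) = 0 := by
        simp only [hBdef, add_sub_cancel_right]; exact bump_radius hlam hq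
      linarith
  have ha' : a = -r + s₀ := by
    have hv : U l = B l := heq' ⟨le_rfl, hlm⟩
    rcases lt_trichotomy a (-r + s₀) with h1 | h1 | h1
    · rw [hl, max_eq_right h1.le] at hv
      have h2 := (h (-r + s₀) ⟨h1, by linarith [hs.2]⟩).1
      have h3 : B (-r + s₀) = 0 := by
        simp only [hBdef, add_sub_cancel_right]; exact bump_neg_radius hlam hq
      linarith
    · exact h1
    · rw [hl, max_eq_left h1.le, ha] at hv
      have := hBpos a ⟨h1, by linarith [hs.1]⟩
      linarith
  refine ⟨M, q, hlam, hM, ⟨hq0, hq1⟩, hrel, by rw [ha', hb']; ring, ?_⟩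
  rw [hl, hm, ← ha', ← hb', max_self, min_self] at heq'
  have hmid : (a + b) / 2 = s₀ := by rw [ha', hb']; ring
  rw [hmid]
  exact heq'

end classification


/-! ### Positive and nonnegative solutions -/

section solutions

variable {V₀ R lam : ℝ} {U : ℝ → ℝ}

lemma singularTerm_of_pos {u : ℝ} (h : 0 < u) : singularTerm V₀ u = V₀ / √u := if_pos h

@[simp] lemma singularTerm_zero : singularTerm V₀ 0 = 0 := if_neg (lt_irrefl 0)

lemma singularTerm_nonneg (hV : 0 ≤ V₀) (u : ℝ) : 0 ≤ singularTerm V₀ u := by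
  unfold singularTerm; split_ifs <;> positivity

lemma IsPositiveSolution.solvesOn (h : IsPositiveSolution V₀ R lam U) :
    SolvesOn V₀ lam U (-R) R := by
  intro s hs
  have h2 := (contDiffOn_succ_iff_deriv_of_isOpen (n := 1) isOpen_Ioo).mp
    (by simpa [one_add_one_eq_two] using h.contDiffOn)
  have hd := (h2.2.2.differentiableOn (by norm_num)).differentiableAt (isOpen_Ioo.mem_nhds hs)
  refine ⟨h.pos s hs, h2.1.differentiableAt (isOpen_Ioo.mem_nhds hs), ?_⟩
  have e : V₀ / √(U s) - lam * U s = deriv (deriv U) s := by linarith [h.equation s hs]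
  rw [e]
  exact hd.hasDerivAt

lemma SolvesOn.continuousAt {a b s : ℝ} (h : SolvesOn V₀ lam U a b) (hs : s ∈ Ioo a b) :
    ContinuousAt U s := (h s hs).2.1.continuousAt

lemma SolvesOn.continuousAt_rhs {a b s : ℝ} (h : SolvesOn V₀ lam U a b) (hs : s ∈ Ioo a b) :
    ContinuousAt (fun s => V₀ / √(U s) - lam * U s) s := by
  have hc := h.continuousAt hs
  have := (Real.sqrt_pos.mpr (h s hs).1).ne'
  exact (continuousAt_const.div hc.sqrt this).sub (continuousAt_const.mul hc)

lemma SolvesOn.isPositiveSolution (h : SolvesOn V₀ lam U (-R) R)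
    (hc : ContinuousOn U (Icc (-R) R)) (hl : U (-R) = 0) (hr : U R = 0) :
    IsPositiveSolution V₀ R lam U where
  continuousOn := hc
  contDiffOn := by
    have h1 : ContDiffOn ℝ (0 + 1) (deriv U) (Ioo (-R) R) := by
      rw [contDiffOn_succ_iff_deriv_of_isOpen isOpen_Ioo]
      refine ⟨fun s hs => (h s hs).2.2.differentiableAt.differentiableWithinAt, by simp, ?_⟩
      rw [contDiffOn_zero]
      exact ContinuousOn.congr (fun s hs => (h.continuousAt_rhs hs).continuousWithinAt)
        fun s hs => (h s hs).2.2.deriv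
    have h2 : ContDiffOn ℝ (1 + 1) U (Ioo (-R) R) := by
      rw [contDiffOn_succ_iff_deriv_of_isOpen isOpen_Ioo]
      exact ⟨fun s hs => (h s hs).2.1.differentiableWithinAt, by simp, by simpa using h1⟩
    simpa [one_add_one_eq_two] using h2
  left_eq := hl
  right_eq := hr
  pos := fun s hs => (h s hs).1
  equation := fun s hs => by rw [(h s hs).2.2.deriv]; ring

lemma IsPositiveSolution.isNontrivialNonnegSolution (hR : 0 < R)
    (h : IsPositiveSolution V₀ R lam U) : IsNontrivialNonnegSolution V₀ R lam U := by
  have hs := h.solvesOn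
  have hcong : ∀ x ∈ Ioo (-R) R, ∀ y ∈ Ioo (-R) R, uIcc x y ⊆ Ioo (-R) R := fun x hx y hy =>
    ordConnected_Ioo.uIcc_subset hx hy
  have hint : ∀ x ∈ Ioo (-R) R, ∀ y ∈ Ioo (-R) R,
      IntervalIntegrable (fun s => V₀ / √(U s) - lam * U s) volume x y := fun x hx y hy =>
    ContinuousOn.intervalIntegrable fun s h' =>
      (hs.continuousAt_rhs (hcong x hx y hy h')).continuousWithinAt
  refine ⟨⟨h.continuousOn, h.left_eq, h.right_eq, ?_, fun s h' => (hs s h').2.1, ?_, ?_⟩, 0,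
    ⟨by linarith, hR.le⟩, (h.pos 0 ⟨by linarith, hR⟩).ne'⟩
  · rintro s ⟨h1, h2⟩
    rcases h1.eq_or_lt with rfl | h1
    · exact h.left_eq.ge
    rcases h2.eq_or_lt with rfl | h2
    · exact h.right_eq.ge
    exact (h.pos s ⟨h1, h2⟩).le
  · intro x hx y hy
    refine ContinuousOn.intervalIntegrable (ContinuousOn.congr (f := fun s => V₀ / √(U s)) ?_ ?_)
    · intro s h'
      have h'' := hcong x hx y hy h'
      exact (continuousAt_const.div (hs.continuousAt h'').sqrt
        (Real.sqrt_pos.mpr (h.pos s h'')).ne').continuousWithinAt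
    · exact fun s h' => singularTerm_of_pos (h.pos s (hcong x hx y hy h'))
  · intro x hx y hy
    rw [← intervalIntegral.integral_eq_sub_of_hasDerivAt
      (fun s h' => (hs s (hcong x hx y hy h')).2.2) (hint x hx y hy)]
    refine intervalIntegral.integral_congr fun s h' => ?_
    simp only [singularTerm_of_pos (h.pos s (hcong x hx y hy h'))]

lemma IsNonnegSolution.intervalIntegrable_rhs (h : IsNonnegSolution V₀ R lam U) {x y : ℝ}
    (hx : x ∈ Ioo (-R) R) (hy : y ∈ Ioo (-R) R) :
    IntervalIntegrable (fun s => singularTerm V₀ (U s) - lam * U s) volume x y := by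
  refine (h.integrable x hx y hy).sub (ContinuousOn.intervalIntegrable ?_)
  exact continuousOn_const.mul (h.continuousOn.mono
    ((ordConnected_Ioo.uIcc_subset hx hy).trans Ioo_subset_Icc_self))

lemma IsNonnegSolution.continuousAt_deriv (h : IsNonnegSolution V₀ R lam U) {s : ℝ}
    (hs : s ∈ Ioo (-R) R) : ContinuousAt (deriv U) s := by
  obtain ⟨c, hc1, hc2⟩ := exists_between hs.1
  obtain ⟨d, hd1, hd2⟩ := exists_between hs.2
  have hc : c ∈ Ioo (-R) R := ⟨hc1, hc2.trans hs.2⟩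
  have hd : d ∈ Ioo (-R) R := ⟨hs.1.trans hd1, hd2⟩
  have h1 := intervalIntegral.continuousOn_primitive_interval'
    (h.intervalIntegrable_rhs hc hd) left_mem_uIcc
  rw [uIcc_of_le (hc2.trans hd1).le] at h1
  have h2 := (h1.continuousAt (Icc_mem_nhds hc2 hd1)).const_add (deriv U c)
  refine h2.congr ?_
  filter_upwards [isOpen_Ioo.mem_nhds hs] with y hy
  rw [← h.equation c hc y hy]
  ring

lemma IsNonnegSolution.deriv_eq_zero (h : IsNonnegSolution V₀ R lam U) {s : ℝ}
    (hs : s ∈ Ioo (-R) R) (h0 : U s = 0) : deriv U s = 0 := by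
  have : IsLocalMin U s := by
    filter_upwards [isOpen_Ioo.mem_nhds hs] with y hy
    rw [h0]
    exact h.nonneg y (Ioo_subset_Icc_self hy)
  exact this.deriv_eq_zero

lemma IsNonnegSolution.solvesOn (h : IsNonnegSolution V₀ R lam U) {a b : ℝ} (ha : -R ≤ a)
    (hb : b ≤ R) (hpos : ∀ s ∈ Ioo a b, 0 < U s) : SolvesOn V₀ lam U a b := by
  have hsub : Ioo a b ⊆ Ioo (-R) R := Ioo_subset_Ioo ha hb
  have hf : ∀ s ∈ Ioo a b, ContinuousAt (fun s => singularTerm V₀ (U s) - lam * U s) s := by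
    intro s hs
    have hc : ContinuousAt U s := (h.differentiableAt s (hsub hs)).continuousAt
    have : ContinuousAt (fun s => V₀ / √(U s) - lam * U s) s :=
      (continuousAt_const.div hc.sqrt (Real.sqrt_pos.mpr (hpos s hs)).ne').sub
        (continuousAt_const.mul hc)
    refine this.congr ?_
    filter_upwards [isOpen_Ioo.mem_nhds hs] with y hy
    rw [singularTerm_of_pos (hpos y hy)]
  intro s hs
  refine ⟨hpos s hs, h.differentiableAt s (hsub hs), ?_⟩
  have h1 := (intervalIntegral.integral_hasDerivAt_right
    (IntervalIntegrable.refl (a := s))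
    (ContinuousAt.stronglyMeasurableAtFilter isOpen_Ioo hf s hs) (hf s hs)).const_add (deriv U s)
  rw [singularTerm_of_pos (hpos s hs)] at h1
  refine h1.congr_of_eventuallyEq ?_
  filter_upwards [isOpen_Ioo.mem_nhds hs] with y hy
  rw [← h.equation s (hsub hs) y (hsub hy)]
  ring

/-- The component of `{U > 0}` around a point where `U` is positive. -/
lemma IsNonnegSolution.exists_component (h : IsNonnegSolution V₀ R lam U) {s : ℝ}
    (hs : s ∈ Icc (-R) R) (hne : U s ≠ 0) :
    ∃ a b, -R ≤ a ∧ a < s ∧ s < b ∧ b ≤ R ∧ U a = 0 ∧ U b = 0 ∧ ∀ x ∈ Ioo a b, 0 < U x := by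
  have hz : IsCompact (Icc (-R) R ∩ U ⁻¹' {0}) :=
    isCompact_Icc.of_isClosed_subset
      (h.continuousOn.preimage_isClosed_of_isClosed isClosed_Icc isClosed_singleton)
      inter_subset_left
  have hRR : -R ≤ R := hs.1.trans hs.2
  obtain ⟨a, ⟨⟨ha, ha0⟩, has⟩, hamax⟩ := (hz.inter_right (isClosed_Iic (a := s))).exists_isGreatest
    ⟨-R, ⟨⟨⟨le_rfl, hRR⟩, h.left_eq⟩, hs.1⟩⟩
  obtain ⟨b, ⟨⟨hb, hb0⟩, hbs⟩, hbmin⟩ := (hz.inter_right (isClosed_Ici (a := s))).exists_isLeast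
    ⟨R, ⟨⟨⟨hRR, le_rfl⟩, h.right_eq⟩, hs.2⟩⟩
  have has' : a < s := lt_of_le_of_ne has (by rintro rfl; exact hne ha0)
  have hbs' : s < b := lt_of_le_of_ne hbs (by rintro rfl; exact hne hb0)
  refine ⟨a, b, ha.1, has', hbs', hb.2, ha0, hb0, fun x hx => ?_⟩
  have hx' : x ∈ Icc (-R) R := ⟨ha.1.trans hx.1.le, hx.2.le.trans hb.2⟩
  refine lt_of_le_of_ne (h.nonneg x hx') fun h0 => ?_
  rcases le_total x s with hxs | hxs
  · exact absurd (hamax ⟨⟨hx', h0.symm⟩, hxs⟩) (not_le.mpr hx.1)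
  · exact absurd (hbmin ⟨⟨hx', h0.symm⟩, hxs⟩) (not_le.mpr hx.2)

/-- On the component of `{U > 0}` around `s`, a nonnegative solution is a translated `bump`; if the
component is not the whole interval then the bump is flat, because `U' = 0` at interior zeros. -/
theorem IsNonnegSolution.exists_eq_bump (hV : 0 < V₀) (h : IsNonnegSolution V₀ R lam U) {s : ℝ}
    (hs : s ∈ Icc (-R) R) (hne : U s ≠ 0) :
    ∃ a b M q, -R ≤ a ∧ s ∈ Ioo a b ∧ b ≤ R ∧ 0 < lam ∧ 0 < M ∧ q ∈ Ioc (0 : ℝ) 1 ∧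
      lam * q * (M * √M) = 4 * V₀ ∧ b - a = 2 * bumpRadius lam q ∧
      EqOn U (fun s => bump lam M q (s - (a + b) / 2)) (Icc a b) ∧
      (q = 1 ∨ a = -R ∧ b = R) := by
  obtain ⟨a, b, ha, has, hsb, hb, ha0, hb0, hpos⟩ := h.exists_component hs hne
  obtain ⟨M, q, hlam, hM, hq, hrel, hlen, heq⟩ :=
    (h.solvesOn ha hb hpos).exists_eq_bump hV (has.trans hsb)
      (h.continuousOn.mono (Icc_subset_Icc ha hb)) ha0 hb0
  refine ⟨a, b, M, q, ha, ⟨has, hsb⟩, hb, hlam, hM, hq, hrel, hlen, heq, ?_⟩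
  have hq' : q ∈ Icc (0 : ℝ) 1 := ⟨hq.1.le, hq.2⟩
  have hab := has.trans hsb
  set m := (a + b) / 2 with hm
  have hml : a = m + -bumpRadius lam q := by rw [hm]; linarith
  have hmr : b = m + bumpRadius lam q := by rw [hm]; linarith
  have hder : ∀ x ∈ Ioo a b, deriv U x = deriv (bump lam M q) (x - m) := by
    intro x hx
    rw [← deriv_comp_sub_const (f := bump lam M q) m x]
    exact Filter.EventuallyEq.deriv_eq (heq.eventuallyEq_of_mem (Icc_mem_nhds hx.1 hx.2))
  -- a vanishing limit slope at one end forces `q = 1`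
  have hflat : M * √lam * √(1 - q) = 0 → q = 1 := by
    intro h0
    have h1 : √(1 - q) = 0 := by
      have := Real.sqrt_pos.mpr hlam
      rcases mul_eq_zero.mp h0 with h0 | h0
      · exact absurd h0 (by positivity)
      · exact h0
    rw [Real.sqrt_eq_zero (by linarith [hq.2])] at h1
    linarith
  by_cases h1 : a = -R
  · by_cases h2 : b = R
    · exact Or.inr ⟨h1, h2⟩
    · left
      have hbR : b ∈ Ioo (-R) R := ⟨by linarith, lt_of_le_of_ne hb h2⟩
      have hl1 : Tendsto (deriv U) (𝓝[<] b) (𝓝 0) := by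
        have := (h.continuousAt_deriv hbR).tendsto
        rw [h.deriv_eq_zero hbR hb0] at this
        exact this.mono_left nhdsWithin_le_nhds
      have hsh : Tendsto (fun x => x - m) (𝓝[<] b) (𝓝[<] (bumpRadius lam q)) := by
        refine tendsto_nhdsWithin_iff.mpr ⟨?_, ?_⟩
        · have : ContinuousAt (fun x : ℝ => x - m) b := by fun_prop
          have h3 := this.tendsto.mono_left (nhdsWithin_le_nhds (s := Iio b))
          rwa [show b - m = bumpRadius lam q by linarith] at h3
        · filter_upwards [self_mem_nhdsWithin] with x hx
          have : x < b := hx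
          show x - m < _
          linarith
      have hl2 := (tendsto_deriv_bump_right (M := M) hlam hq').comp hsh
      have hl3 : Tendsto (deriv U) (𝓝[<] b) (𝓝 (-(M * √lam * √(1 - q)))) := by
        refine hl2.congr' ?_
        filter_upwards [Ioo_mem_nhdsLT hab] with x hx using (hder x hx).symm
      have := tendsto_nhds_unique hl1 hl3
      exact hflat (by linarith)
  · left
    have haR : a ∈ Ioo (-R) R := ⟨lt_of_le_of_ne ha (Ne.symm h1), by linarith⟩
    have hl1 : Tendsto (deriv U) (𝓝[>] a) (𝓝 0) := by
      have := (h.continuousAt_deriv haR).tendsto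
      rw [h.deriv_eq_zero haR ha0] at this
      exact this.mono_left nhdsWithin_le_nhds
    have hsh : Tendsto (fun x => x - m) (𝓝[>] a) (𝓝[>] (-bumpRadius lam q)) := by
      refine tendsto_nhdsWithin_iff.mpr ⟨?_, ?_⟩
      · have : ContinuousAt (fun x : ℝ => x - m) a := by fun_prop
        have h3 := this.tendsto.mono_left (nhdsWithin_le_nhds (s := Ioi a))
        rwa [show a - m = -bumpRadius lam q by linarith] at h3
      · filter_upwards [self_mem_nhdsWithin] with x hx
        have : a < x := hx
        show _ < x - m
        linarith
    have hl2 := (tendsto_deriv_bump_left (M := M) hlam hq').comp hsh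
    have hl3 : Tendsto (deriv U) (𝓝[>] a) (𝓝 (M * √lam * √(1 - q))) := by
      refine hl2.congr' ?_
      filter_upwards [Ioo_mem_nhdsGT hab] with x hx using (hder x hx).symm
    exact hflat (tendsto_nhds_unique hl1 hl3).symm

end solutions

/-! ### The flat solution extended by zero -/

section freeBoundary

variable {V₀ R lam M : ℝ}

/-- The flat solution (`q = 1`), extended by zero: the argument is clamped to the interval of
positivity, at whose ends `bump` vanishes. -/
noncomputable def flatBump (lam M s : ℝ) : ℝ :=
  bump lam M 1 (max (-bumpRadius lam 1) (min s (bumpRadius lam 1)))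

/-- The derivative of `flatBump`. -/
noncomputable def flatBumpSlope (lam M s : ℝ) : ℝ :=
  M * √lam * profileSlope 1 (√lam * max (-bumpRadius lam 1) (min s (bumpRadius lam 1)))

lemma one_mem_Icc : (1 : ℝ) ∈ Icc (0 : ℝ) 1 := by simp

lemma continuous_flatBump : Continuous (flatBump lam M) :=
  (continuous_bump one_mem_Icc).comp (by fun_prop)

lemma clamp_mem_Icc (hlam : 0 < lam) (s : ℝ) :
    max (-bumpRadius lam 1) (min s (bumpRadius lam 1)) ∈
      Icc (-bumpRadius lam 1) (bumpRadius lam 1) := by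
  have := bumpRadius_pos hlam one_mem_Icc
  exact ⟨le_max_left _ _, max_le (by linarith) (min_le_right _ _)⟩

lemma continuous_flatBumpSlope (hlam : 0 < lam) : Continuous (flatBumpSlope lam M) := by
  refine continuous_const.mul ?_
  exact (continuousOn_profileSlope one_mem_Icc).comp_continuous (by fun_prop)
    fun s => mul_mem_Icc hlam (clamp_mem_Icc hlam s)

lemma clamp_of_mem {r s : ℝ} (hs : s ∈ Icc (-r) r) : max (-r) (min s r) = s := by
  rw [min_eq_left hs.2, max_eq_right hs.1]

lemma clamp_of_ge {r s : ℝ} (hr : 0 < r) (hs : r ≤ s) : max (-r) (min s r) = r := by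
  rw [min_eq_right hs, max_eq_right (by linarith)]

lemma clamp_of_le {r s : ℝ} (hr : 0 < r) (hs : s ≤ -r) : max (-r) (min s r) = -r := by
  rw [min_eq_left (by linarith), max_eq_left hs]

lemma flatBump_of_mem {s : ℝ} (hs : s ∈ Icc (-bumpRadius lam 1) (bumpRadius lam 1)) :
    flatBump lam M s = bump lam M 1 s := by
  rw [flatBump, clamp_of_mem hs]

lemma flatBump_of_ge (hlam : 0 < lam) {s : ℝ} (hs : bumpRadius lam 1 ≤ s) :
    flatBump lam M s = 0 := by
  rw [flatBump, clamp_of_ge (bumpRadius_pos hlam one_mem_Icc) hs, bump_radius hlam one_mem_Icc]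

lemma flatBump_of_le (hlam : 0 < lam) {s : ℝ} (hs : s ≤ -bumpRadius lam 1) :
    flatBump lam M s = 0 := by
  rw [flatBump, clamp_of_le (bumpRadius_pos hlam one_mem_Icc) hs, bump_neg_radius hlam one_mem_Icc]

lemma flatBumpSlope_of_ge (hlam : 0 < lam) {s : ℝ} (hs : bumpRadius lam 1 ≤ s) :
    flatBumpSlope lam M s = 0 := by
  rw [flatBumpSlope, clamp_of_ge (bumpRadius_pos hlam one_mem_Icc) hs, sqrt_mul_bumpRadius hlam,
    profileSlope_halfWidth one_mem_Icc]
  simp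

lemma flatBumpSlope_of_le (hlam : 0 < lam) {s : ℝ} (hs : s ≤ -bumpRadius lam 1) :
    flatBumpSlope lam M s = 0 := by
  rw [flatBumpSlope, clamp_of_le (bumpRadius_pos hlam one_mem_Icc) hs, mul_neg,
    sqrt_mul_bumpRadius hlam, profileSlope_neg_halfWidth one_mem_Icc]
  simp

lemma flatBump_nonneg (hlam : 0 < lam) (hM : 0 ≤ M) (s : ℝ) : 0 ≤ flatBump lam M s :=
  mul_nonneg hM (Real.cos_nonneg_of_mem_Icc
    (angle_mem_Icc one_mem_Icc (mul_mem_Icc hlam (clamp_mem_Icc hlam s))))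

lemma hasDerivAt_flatBump (hlam : 0 < lam) (s : ℝ) :
    HasDerivAt (flatBump lam M) (flatBumpSlope lam M s) s := by
  have hr := bumpRadius_pos hlam one_mem_Icc
  rcases lt_trichotomy s (-bumpRadius lam 1) with h1 | h1 | h1
  · rw [flatBumpSlope_of_le hlam h1.le]
    refine (hasDerivAt_const s (0 : ℝ)).congr_of_eventuallyEq ?_
    filter_upwards [Iio_mem_nhds h1] with x hx using flatBump_of_le hlam (le_of_lt hx)
  · rw [flatBumpSlope_of_le hlam h1.le, ← hasDerivWithinAt_univ, ← Iic_union_Ici (a := s)]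
    refine HasDerivWithinAt.union ?_ ?_
    · exact (hasDerivWithinAt_const s _ (0 : ℝ)).congr
        (fun x hx => flatBump_of_le hlam (le_trans hx h1.le)) (flatBump_of_le hlam h1.le)
    · have h2 := hasDerivWithinAt_bump_left (M := M) hlam one_mem_Icc
      rw [sub_self, Real.sqrt_zero, mul_zero, ← h1] at h2
      refine h2.congr_of_eventuallyEq ?_ (flatBump_of_mem ⟨h1.ge, by linarith⟩)
      filter_upwards [self_mem_nhdsWithin, nhdsWithin_le_nhds (Iio_mem_nhds
        (show s < bumpRadius lam 1 by linarith))] with x hx hx'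
      exact flatBump_of_mem ⟨h1.ge.trans hx, le_of_lt hx'⟩
  rcases lt_trichotomy s (bumpRadius lam 1) with h3 | h3 | h3
  · have h2 := hasDerivAt_bump (M := M) hlam one_mem_Icc ⟨h1, h3⟩
    rw [flatBumpSlope, clamp_of_mem ⟨h1.le, h3.le⟩]
    refine h2.congr_of_eventuallyEq ?_
    filter_upwards [Icc_mem_nhds h1 h3] with x hx using flatBump_of_mem hx
  · rw [flatBumpSlope_of_ge hlam h3.ge, ← hasDerivWithinAt_univ, ← Iic_union_Ici (a := s)]
    refine HasDerivWithinAt.union ?_ ?_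
    · have h2 := hasDerivWithinAt_bump_right (M := M) hlam one_mem_Icc
      rw [sub_self, Real.sqrt_zero, mul_zero, neg_zero, ← h3] at h2
      refine h2.congr_of_eventuallyEq ?_ (flatBump_of_mem ⟨h1.le, h3.le⟩)
      filter_upwards [self_mem_nhdsWithin, nhdsWithin_le_nhds (Ioi_mem_nhds h1)] with x hx hx'
      exact flatBump_of_mem ⟨le_of_lt hx', le_trans hx h3.le⟩
    · exact (hasDerivWithinAt_const s _ (0 : ℝ)).congr
        (fun x hx => flatBump_of_ge hlam (le_trans h3.ge hx)) (flatBump_of_ge hlam h3.ge)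
  · rw [flatBumpSlope_of_ge hlam h3.le]
    refine (hasDerivAt_const s (0 : ℝ)).congr_of_eventuallyEq ?_
    filter_upwards [Ioi_mem_nhds h3] with x hx using flatBump_of_ge hlam (le_of_lt hx)

lemma deriv_flatBump (hlam : 0 < lam) : deriv (flatBump lam M) = flatBumpSlope lam M :=
  funext fun s => (hasDerivAt_flatBump hlam s).deriv

lemma hasDerivAt_flatBumpSlope (hlam : 0 < lam) (hM : 0 < M) (h : lam * (M * √M) = 4 * V₀) {s : ℝ}
    (h1 : s ≠ -bumpRadius lam 1) (h2 : s ≠ bumpRadius lam 1) :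
    HasDerivAt (flatBumpSlope lam M)
      (singularTerm V₀ (flatBump lam M s) - lam * flatBump lam M s) s := by
  rcases lt_or_gt_of_ne h1 with h1 | h1
  · rw [flatBump_of_le hlam h1.le, singularTerm_zero, mul_zero, sub_zero]
    refine (hasDerivAt_const s (0 : ℝ)).congr_of_eventuallyEq ?_
    filter_upwards [Iio_mem_nhds h1] with x hx using flatBumpSlope_of_le hlam (le_of_lt hx)
  rcases lt_or_gt_of_ne h2 with h2 | h2
  · obtain ⟨p1, -, p3⟩ := solvesOn_bump (V₀ := V₀) hlam hM one_mem_Icc (by rwa [mul_one]) s ⟨h1, h2⟩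
    rw [flatBump_of_mem ⟨h1.le, h2.le⟩, singularTerm_of_pos p1]
    refine p3.congr_of_eventuallyEq ?_
    filter_upwards [Ioo_mem_nhds h1 h2] with x hx
    rw [← deriv_flatBump hlam]
    refine Filter.EventuallyEq.deriv_eq ?_
    filter_upwards [Icc_mem_nhds hx.1 hx.2] with y hy using flatBump_of_mem hy
  · rw [flatBump_of_ge hlam h2.le, singularTerm_zero, mul_zero, sub_zero]
    refine (hasDerivAt_const s (0 : ℝ)).congr_of_eventuallyEq ?_
    filter_upwards [Ioi_mem_nhds h2] with x hx using flatBumpSlope_of_ge hlam (le_of_lt hx)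

lemma intervalIntegrable_singularTerm_flatBump (hV : 0 ≤ V₀) (hlam : 0 < lam) (hM : 0 < M)
    (h : lam * (M * √M) = 4 * V₀) (x y : ℝ) :
    IntervalIntegrable (fun s => singularTerm V₀ (flatBump lam M s)) volume x y := by
  -- the singular term is the derivative of a continuous function and is nonnegative
  have hprim : ∀ s, HasDerivAt (fun s => ∫ t in (0 : ℝ)..s, lam * flatBump lam M t)
      (lam * flatBump lam M s) s := fun s =>
    (continuous_const.mul continuous_flatBump).integral_hasStrictDerivAt 0 s |>.hasDerivAt
  have key : ∀ c d, c ≤ d → -bumpRadius lam 1 ∉ Ioo c d → bumpRadius lam 1 ∉ Ioo c d →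
      IntervalIntegrable (fun s => singularTerm V₀ (flatBump lam M s)) volume c d := by
    intro c d hcd n1 n2
    refine intervalIntegral.intervalIntegrable_deriv_of_nonneg
      (g := fun s => flatBumpSlope lam M s + ∫ t in (0 : ℝ)..s, lam * flatBump lam M t)
      ?_ ?_ fun s _ => singularTerm_nonneg hV _
    · exact ((continuous_flatBumpSlope hlam).add
        (continuous_iff_continuousAt.mpr fun s => (hprim s).continuousAt)).continuousOn
    · intro s hs
      rw [min_eq_left hcd, max_eq_right hcd] at hs
      have := (hasDerivAt_flatBumpSlope hlam hM h (s := s) (by rintro rfl; exact n1 hs)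
        (by rintro rfl; exact n2 hs)).add (hprim s)
      exact this.congr_deriv (by ring)
  have hr := bumpRadius_pos hlam one_mem_Icc
  set r := bumpRadius lam 1
  have hright : ∀ c, r ≤ c →
      IntervalIntegrable (fun s => singularTerm V₀ (flatBump lam M s)) volume 0 c := fun c hc =>
    (key 0 r hr.le (fun h' => by linarith [h'.1]) (fun h' => by linarith [h'.2])).trans
      (key r c hc (fun h' => by linarith [h'.1]) (fun h' => by linarith [h'.1]))
  have hleft : ∀ c, c ≤ -r →
      IntervalIntegrable (fun s => singularTerm V₀ (flatBump lam M s)) volume c 0 := fun c hc =>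
    (key c (-r) hc (fun h' => by linarith [h'.2]) (fun h' => by linarith [h'.2])).trans
      (key (-r) 0 (by linarith) (fun h' => by linarith [h'.1]) (fun h' => by linarith [h'.2]))
  refine ((hleft (min (min x y) (-r)) (min_le_right _ _)).trans
    (hright (max (max x y) r) (le_max_right _ _))).mono_set ?_
  rw [uIcc_of_le (a := min _ _) ((min_le_right _ _).trans (by linarith [le_max_right (max x y) r]))]
  exact Icc_subset_Icc (min_le_left _ _) (le_max_left _ _)

theorem isNontrivialNonnegSolution_flatBump (hV : 0 < V₀) (hlam : 0 < lam) (hM : 0 < M)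
    (h : lam * (M * √M) = 4 * V₀) (hR : bumpRadius lam 1 ≤ R) :
    IsNontrivialNonnegSolution V₀ R lam (flatBump lam M) := by
  have hr := bumpRadius_pos hlam one_mem_Icc
  refine ⟨⟨continuous_flatBump.continuousOn, flatBump_of_le hlam (by linarith),
    flatBump_of_ge hlam hR, fun s _ => flatBump_nonneg hlam hM.le s,
    fun s _ => (hasDerivAt_flatBump hlam s).differentiableAt,
    fun x _ y _ => intervalIntegrable_singularTerm_flatBump hV.le hlam hM h x y, ?_⟩,
    0, ⟨by linarith, by linarith⟩, ?_⟩
  · intro x _ y _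
    rw [deriv_flatBump hlam]
    refine (MeasureTheory.integral_eq_of_hasDerivAt_off_countable (flatBumpSlope lam M) _
      (s := {-bumpRadius lam 1, bumpRadius lam 1}) (Set.toFinite _).countable
      (continuous_flatBumpSlope hlam).continuousOn ?_ ?_).symm
    · intro s hs
      have hs2 := hs.2
      simp only [mem_insert_iff, mem_singleton_iff, not_or] at hs2
      exact hasDerivAt_flatBumpSlope hlam hM h hs2.1 hs2.2
    · exact (intervalIntegrable_singularTerm_flatBump hV.le hlam hM h x y).sub
        (continuous_const.mul continuous_flatBump).continuousOn.intervalIntegrable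
  · rw [flatBump_of_mem ⟨by linarith, hr.le⟩, bump_zero one_mem_Icc]
    exact hM.ne'

end freeBoundary


/-! ### The first eigenvalue of the linear problem -/

section eigenvalue

variable {R lam : ℝ} {φ : ℝ → ℝ}

/-- Comparison with `cos (ω s)`, `lam < ω² < lambdaOne R`: the least multiple of the cosine lying
above `φ` would touch it at an interior point, against the second derivative test. -/
lemma nonpos_of_lt_lambdaOne (hR : 0 < R) (hlam : lam < lambdaOne R)
    (hc : ContinuousOn φ (Icc (-R) R)) (hd : ContDiffOn ℝ 2 φ (Ioo (-R) R)) (hl : φ (-R) = 0)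
    (hr : φ R = 0) (heq : ∀ s ∈ Ioo (-R) R, -deriv (deriv φ) s = lam * φ s) :
    ∀ s ∈ Ioo (-R) R, φ s ≤ 0 := by
  by_contra! hcon
  obtain ⟨s₁, hs₁, hpos⟩ := hcon
  have hpi := Real.pi_pos
  have hlt : √lam < Real.pi / (2 * R) := (Real.sqrt_lt' (by positivity)).mpr hlam
  obtain ⟨ω, hω1, hω2⟩ := exists_between hlt
  have hω0 : 0 < ω := (Real.sqrt_nonneg lam).trans_lt hω1
  have hωlam : lam < ω ^ 2 := (Real.sqrt_lt' hω0).mp hω1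
  have hωR : ω * R < Real.pi / 2 := by
    have := (lt_div_iff₀ (by positivity)).mp hω2
    linarith
  have hcos : ∀ s ∈ Icc (-R) R, 0 < Real.cos (ω * s) := fun s hs =>
    Real.cos_pos_of_mem_Ioo ⟨by nlinarith [hs.1], by nlinarith [hs.2]⟩
  have hv : ContinuousOn (fun s => φ s / Real.cos (ω * s)) (Icc (-R) R) :=
    hc.div (by fun_prop) fun s hs => (hcos s hs).ne'
  obtain ⟨s₀, hs₀, hmax⟩ := isCompact_Icc.exists_isMaxOn ⟨s₁, Ioo_subset_Icc_self hs₁⟩ hv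
  set m := φ s₀ / Real.cos (ω * s₀) with hm
  have hm0 : 0 < m :=
    (div_pos hpos (hcos s₁ (Ioo_subset_Icc_self hs₁))).trans_le (hmax (Ioo_subset_Icc_self hs₁))
  have hφ0 : φ s₀ = m * Real.cos (ω * s₀) := by
    rw [hm, div_mul_cancel₀ _ (hcos s₀ hs₀).ne']
  have hs : s₀ ∈ Ioo (-R) R := by
    refine ⟨lt_of_le_of_ne hs₀.1 ?_, lt_of_le_of_ne hs₀.2 ?_⟩
    · rintro rfl; rw [hm, hl, zero_div] at hm0; exact hm0.false
    · rintro rfl; rw [hm, hr, zero_div] at hm0; exact hm0.false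
  set g : ℝ → ℝ := fun s => m * Real.cos (ω * s) - φ s with hg
  have hg0 : g s₀ = 0 := by simp [hg, hφ0]
  have hmin : IsLocalMin g s₀ := by
    filter_upwards [Icc_mem_nhds hs.1 hs.2] with s h'
    rw [hg0]
    have h1 : φ s / Real.cos (ω * s) ≤ m := hmax h'
    have := (div_le_iff₀ (hcos s h')).mp h1
    simp only [hg]
    linarith
  have hcd := (contDiffOn_succ_iff_deriv_of_isOpen (n := 1) isOpen_Ioo).mp
    (by simpa [one_add_one_eq_two] using hd)
  have hsin : ∀ s, HasDerivAt (fun s => m * Real.cos (ω * s)) (-(m * ω * Real.sin (ω * s))) s := by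
    intro s
    have := (((hasDerivAt_id s).const_mul ω).cos).const_mul m
    exact this.congr_deriv (by simp; ring)
  have hg' : ∀ s ∈ Ioo (-R) R, deriv g s = -(m * ω * Real.sin (ω * s)) - deriv φ s := fun s h' =>
    ((hsin s).sub (hcd.1.differentiableAt (isOpen_Ioo.mem_nhds h')).hasDerivAt).deriv
  have hg'' : deriv (deriv g) s₀ < 0 := by
    have h1 : HasDerivAt (fun s => -(m * ω * Real.sin (ω * s)))
        (-(m * ω ^ 2 * Real.cos (ω * s₀))) s₀ := by
      have := ((((hasDerivAt_id s₀).const_mul ω).sin).const_mul (m * ω)).neg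
      exact this.congr_deriv (by simp; ring)
    have h2 := ((hcd.2.2.differentiableOn (by norm_num)).differentiableAt
      (isOpen_Ioo.mem_nhds hs)).hasDerivAt
    have h3 : deriv g =ᶠ[𝓝 s₀] fun s => -(m * ω * Real.sin (ω * s)) - deriv φ s := by
      filter_upwards [isOpen_Ioo.mem_nhds hs] with s h' using hg' s h'
    rw [h3.deriv_eq, (h1.fun_sub h2).deriv]
    have h4 := heq s₀ hs
    rw [hφ0] at h4
    have := mul_pos hm0 (hcos s₀ hs₀)
    nlinarith
  have hgc : ContinuousAt g s₀ :=
    ((hsin s₀).sub (hcd.1.differentiableAt (isOpen_Ioo.mem_nhds hs)).hasDerivAt).continuousAt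
  have hmaxg := isLocalMax_of_deriv_deriv_neg hg'' hmin.deriv_eq_zero hgc
  have hconst : g =ᶠ[𝓝 s₀] fun _ => g s₀ := by
    filter_upwards [hmin, hmaxg] with s h1 h2 using le_antisymm h2 h1
  have h0 : deriv (deriv g) s₀ = 0 := by
    rw [hconst.deriv.deriv_eq]
    simp
  linarith

theorem isLeast_lambdaOne (hR : 0 < R) :
    IsLeast {lam : ℝ | IsDirichletEigenvalue R lam} (lambdaOne R) := by
  constructor
  · have h1 : ∀ s, HasDerivAt (fun s => Real.cos (Real.pi / (2 * R) * s))
        (-(Real.pi / (2 * R) * Real.sin (Real.pi / (2 * R) * s))) s := by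
      intro s
      have := ((hasDerivAt_id s).const_mul (Real.pi / (2 * R))).cos
      exact this.congr_deriv (by simp; ring)
    have h2 : ∀ s, HasDerivAt (fun s => -(Real.pi / (2 * R) * Real.sin (Real.pi / (2 * R) * s)))
        (-(lambdaOne R * Real.cos (Real.pi / (2 * R) * s))) s := by
      intro s
      have := (((hasDerivAt_id s).const_mul (Real.pi / (2 * R))).sin.const_mul
        (Real.pi / (2 * R))).neg
      exact this.congr_deriv (by simp [lambdaOne]; ring)
    have e : Real.pi / (2 * R) * R = Real.pi / 2 := by field_simp
    refine ⟨fun s => Real.cos (Real.pi / (2 * R) * s), by fun_prop, by fun_prop, ?_, ?_, ?_, 0,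
      ⟨by linarith, hR⟩, by simp⟩
    · simp [e]
    · simp [e]
    · intro s _
      have e1 : deriv (fun s => Real.cos (Real.pi / (2 * R) * s)) =
          fun s => -(Real.pi / (2 * R) * Real.sin (Real.pi / (2 * R) * s)) :=
        funext fun x => (h1 x).deriv
      rw [e1, (h2 s).deriv, neg_neg]
  · rintro lam ⟨φ, hc, hd, hl, hr, heq, s, hs, hne⟩
    by_contra! hlt
    have h1 := nonpos_of_lt_lambdaOne hR hlt hc hd hl hr heq s hs
    have h2 := nonpos_of_lt_lambdaOne (φ := fun s => -φ s) hR hlt hc.neg hd.neg (by simp [hl])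
      (by simp [hr]) (fun x hx => by
        have e1 : deriv (fun s => -φ s) = fun s => -deriv φ s := funext fun y => deriv.fun_neg
        rw [e1, deriv.fun_neg]
        linarith [heq x hx]) s hs
    exact hne (le_antisymm h1 (by linarith))

end eigenvalue


/-! ### The bifurcation curve -/

/-- The inverse of `halfWidth` extends to the line as a strictly increasing continuous function,
differentiable with positive derivative at `halfWidth 1`. Beyond `q = 1` the half-width is prolonged
along its left tangent, which makes the derivative two-sided. -/
lemma exists_halfWidth_inverse :
    ∃ Q : ℝ → ℝ, StrictMono Q ∧ Continuous Q ∧ (∀ q ∈ Icc (0 : ℝ) 1, Q (halfWidth q) = q) ∧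
      (∀ x, Q x ∈ Icc (0 : ℝ) 1 → halfWidth (Q x) = x) ∧
      ∃ d, 0 < d ∧ HasDerivAt Q d (halfWidth 1) := by
  obtain ⟨g, hg, hder⟩ := exists_hasDerivWithinAt_halfWidth
  set c : ℝ → ℝ := fun q => max 0 (min q 1) with hc
  have hcI : ∀ q, c q ∈ Icc (0 : ℝ) 1 := fun q =>
    ⟨le_max_left _ _, max_le zero_le_one (min_le_right _ _)⟩
  have hcid : ∀ q ∈ Icc (0 : ℝ) 1, c q = q := fun q hq => by
    simp only [hc]; rw [min_eq_left hq.2, max_eq_right hq.1]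
  have hc1 : ∀ q, 1 ≤ q → c q = 1 := fun q hq => by simp [hc, hq]
  have hc0 : ∀ q, q ≤ 0 → c q = 0 := fun q hq => by
    simp only [hc]; rw [min_eq_left (hq.trans zero_le_one), max_eq_left hq]
  have hcm : Monotone c := fun p q h => max_le_max le_rfl (min_le_min h le_rfl)
  have hcl : ∀ p q, p ≤ q → c q - c p ≤ q - p := by
    intro p q h
    simp only [hc]
    rcases le_total p 1 with h1 | h1 <;> rcases le_total q 1 with h2 | h2 <;>
      rcases le_total p 0 with h3 | h3 <;> rcases le_total q 0 with h4 | h4 <;>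
      simp [*] <;> linarith
  set E : ℝ → ℝ := fun q => halfWidth (c q) + g * (q - c q) with hE
  have hEid : ∀ q ∈ Icc (0 : ℝ) 1, E q = halfWidth q := fun q hq => by
    simp only [hE, hcid q hq]; ring
  have hEmono : StrictMono E := by
    intro p q hpq
    have h1 := hcl p q hpq.le
    simp only [hE]
    rcases (hcm hpq.le).lt_or_eq with h | h
    · have := strictMonoOn_halfWidth (hcI p) (hcI q) h
      nlinarith
    · rw [h]
      nlinarith
  have hEcont : Continuous E := by
    refine (continuousOn_halfWidth.comp_continuous (by fun_prop) hcI).add ?_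
    fun_prop
  have hEsurj : Function.Surjective E := by
    refine hEcont.surjective ?_ ?_
    · have : Tendsto (fun q : ℝ => halfWidth 1 + g * (q - 1)) atTop atTop :=
        tendsto_atTop_add_const_left _ _
          ((tendsto_atTop_add_const_right _ (-1) tendsto_id).const_mul_atTop hg)
      refine this.congr' ?_
      filter_upwards [eventually_ge_atTop 1] with q hq
      simp only [hE, hc1 q hq]
    · have : Tendsto (fun q : ℝ => halfWidth 0 + g * (q - 0)) atBot atBot :=
        tendsto_atBot_add_const_left _ _
          ((tendsto_atBot_add_const_right _ (-0) tendsto_id).const_mul_atBot hg)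
      refine this.congr' ?_
      filter_upwards [eventually_le_atBot 0] with q hq
      simp only [hE, hc0 q hq]
  have hEder : HasDerivAt E g 1 := by
    rw [← hasDerivWithinAt_univ, ← Iic_union_Ici (a := (1 : ℝ))]
    refine HasDerivWithinAt.union ?_ ?_
    · refine hder.congr_of_eventuallyEq ?_ (hEid 1 (by simp))
      filter_upwards [self_mem_nhdsWithin, nhdsWithin_le_nhds (Ioi_mem_nhds zero_lt_one)]
        with q h1 h2 using hEid q ⟨le_of_lt h2, h1⟩
    · have h1 : HasDerivAt (fun q : ℝ => halfWidth 1 + g * (q - 1)) g 1 := by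
        have := (((hasDerivAt_id (1 : ℝ)).sub_const 1).const_mul g).const_add (halfWidth 1)
        exact this.congr_deriv (by simp)
      refine h1.hasDerivWithinAt.congr (fun q hq => ?_) ?_
      · simp only [hE, hc1 q hq]
      · simp only [hE, hc1 1 le_rfl]
  have hr : ∀ x, E (Function.invFun E x) = x := Function.rightInverse_invFun hEsurj
  have hl : ∀ q, Function.invFun E (E q) = q := Function.leftInverse_invFun hEmono.injective
  have hQm : StrictMono (Function.invFun E) := fun x y hxy => by
    rwa [← hEmono.lt_iff_lt, hr, hr]
  have hQc : Continuous (Function.invFun E) :=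
    hQm.monotone.continuous_of_surjective fun q => ⟨E q, hl q⟩
  have hQ : ∀ q ∈ Icc (0 : ℝ) 1, Function.invFun E (halfWidth q) = q := fun q hq => by
    rw [← hEid q hq, hl]
  refine ⟨Function.invFun E, hQm, hQc, hQ, fun x hx => ?_, g⁻¹, inv_pos.mpr hg, ?_⟩
  · rw [← hEid _ hx, hr]
  · refine HasDerivAt.of_local_left_inverse hQc.continuousAt ?_ hg.ne' (Eventually.of_forall hr)
    rwa [hQ 1 (by simp)]

/-- A monotone extension to the line of the inverse of `halfWidth`. -/
noncomputable def halfWidthInv : ℝ → ℝ := exists_halfWidth_inverse.choose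

lemma strictMono_halfWidthInv : StrictMono halfWidthInv := exists_halfWidth_inverse.choose_spec.1

lemma continuous_halfWidthInv : Continuous halfWidthInv := exists_halfWidth_inverse.choose_spec.2.1

lemma halfWidthInv_halfWidth {q : ℝ} (hq : q ∈ Icc (0 : ℝ) 1) : halfWidthInv (halfWidth q) = q :=
  exists_halfWidth_inverse.choose_spec.2.2.1 q hq

lemma halfWidth_halfWidthInv {x : ℝ} (hx : halfWidthInv x ∈ Icc (0 : ℝ) 1) :
    halfWidth (halfWidthInv x) = x :=
  exists_halfWidth_inverse.choose_spec.2.2.2.1 x hx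

lemma exists_hasDerivAt_halfWidthInv : ∃ d, 0 < d ∧ HasDerivAt halfWidthInv d (halfWidth 1) :=
  exists_halfWidth_inverse.choose_spec.2.2.2.2

/-- The parameter `q` of the solutions in an interval of rescaled half-width `x = √lam R`; it
stays equal to `1` once the interval is longer than the support of a flat solution. -/
noncomputable def shape (x : ℝ) : ℝ := min (halfWidthInv x) 1

lemma halfWidthInv_pi_div_two : halfWidthInv (Real.pi / 2) = 0 := by
  rw [← halfWidth_zero]; exact halfWidthInv_halfWidth (by simp)

lemma halfWidthInv_halfWidth_one : halfWidthInv (halfWidth 1) = 1 :=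
  halfWidthInv_halfWidth (by simp)

lemma shape_mem {x : ℝ} (hx : Real.pi / 2 < x) : shape x ∈ Ioc (0 : ℝ) 1 := by
  have := strictMono_halfWidthInv hx
  rw [halfWidthInv_pi_div_two] at this
  exact ⟨lt_min this one_pos, min_le_right _ _⟩

lemma shape_of_le {x : ℝ} (hx : x ≤ halfWidth 1) : shape x = halfWidthInv x := by
  have := strictMono_halfWidthInv.monotone hx
  rw [halfWidthInv_halfWidth_one] at this
  exact min_eq_left this

lemma shape_of_ge {x : ℝ} (hx : halfWidth 1 ≤ x) : shape x = 1 := by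
  have := strictMono_halfWidthInv.monotone hx
  rw [halfWidthInv_halfWidth_one] at this
  exact min_eq_right this

lemma halfWidth_shape {x : ℝ} (hx : Real.pi / 2 < x) (hx' : x ≤ halfWidth 1) :
    halfWidth (shape x) = x := by
  have h := Ioc_subset_Icc_self (shape_mem hx)
  rw [shape_of_le hx'] at h ⊢
  exact halfWidth_halfWidthInv h

lemma eq_shape {q x : ℝ} (hq : q ∈ Ioc (0 : ℝ) 1) (hx : halfWidth q ≤ x)
    (h : q = 1 ∨ halfWidth q = x) : q = shape x := by
  rcases h with rfl | rfl
  · exact (shape_of_ge hx).symm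
  · rw [shape, halfWidthInv_halfWidth (Ioc_subset_Icc_self hq), min_eq_left hq.2]

lemma monotone_shape : Monotone shape := fun _ _ h =>
  min_le_min (strictMono_halfWidthInv.monotone h) le_rfl

lemma continuous_shape : Continuous shape := continuous_halfWidthInv.min continuous_const

lemma pi_div_two_lt_halfWidth {q : ℝ} (hq : q ∈ Ioc (0 : ℝ) 1) : Real.pi / 2 < halfWidth q := by
  rw [← halfWidth_zero]
  exact strictMonoOn_halfWidth (by simp) (Ioc_subset_Icc_self hq) hq.1

/-- The maximum `M` of a solution in terms of `μ = lam * q`. -/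
noncomputable def amplitude (V₀ μ : ℝ) : ℝ := (4 * V₀ / μ) ^ (2 / 3 : ℝ)

section amplitude

variable {V₀ μ : ℝ}

lemma mul_sqrt_eq_rpow {M : ℝ} (hM : 0 < M) : M * √M = M ^ (3 / 2 : ℝ) := by
  rw [Real.sqrt_eq_rpow, show (3 / 2 : ℝ) = 1 + 1 / 2 by norm_num, Real.rpow_add hM, Real.rpow_one]

lemma amplitude_pos (hV : 0 < V₀) (hμ : 0 < μ) : 0 < amplitude V₀ μ := by
  unfold amplitude; positivity

lemma amplitude_spec (hV : 0 < V₀) (hμ : 0 < μ) :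
    μ * (amplitude V₀ μ * √(amplitude V₀ μ)) = 4 * V₀ := by
  rw [mul_sqrt_eq_rpow (amplitude_pos hV hμ), amplitude, ← Real.rpow_mul (by positivity)]
  norm_num
  field_simp

lemma eq_amplitude {M : ℝ} (hμ : 0 < μ) (hM : 0 < M) (h : μ * (M * √M) = 4 * V₀) :
    M = amplitude V₀ μ := by
  rw [mul_sqrt_eq_rpow hM] at h
  rw [amplitude, ← h, mul_div_cancel_left₀ _ hμ.ne', ← Real.rpow_mul hM.le]
  norm_num

lemma amplitude_lt (hV : 0 < V₀) {ν : ℝ} (hμ : 0 < μ) (h : μ < ν) :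
    amplitude V₀ ν < amplitude V₀ μ := by
  have hν := hμ.trans h
  unfold amplitude
  refine Real.rpow_lt_rpow (by positivity) ?_ (by norm_num)
  exact div_lt_div_of_pos_left (by positivity) hμ h

lemma exists_hasDerivAt_amplitude (hV : 0 < V₀) (hμ : 0 < μ) :
    ∃ d, d < 0 ∧ HasDerivAt (amplitude V₀) d μ := by
  have h1 : HasDerivAt (fun μ => 4 * V₀ / μ) (-(4 * V₀) / μ ^ 2) μ := by
    have := (hasDerivAt_const μ (4 * V₀)).div (hasDerivAt_id μ) hμ.ne'
    exact this.congr_deriv (by simp)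
  have h0 : 0 < 4 * V₀ / μ := by positivity
  refine ⟨_, ?_, h1.rpow_const (p := 2 / 3) (Or.inl h0.ne')⟩
  have h2 : 0 < (4 * V₀ / μ) ^ (2 / 3 - 1 : ℝ) := Real.rpow_pos_of_pos h0 _
  have h3 : -(4 * V₀) / μ ^ 2 < 0 := div_neg_of_neg_of_pos (by linarith) (by positivity)
  have h4 : -(4 * V₀) / μ ^ 2 * (2 / 3) < 0 := by linarith
  exact mul_neg_of_neg_of_pos h4 h2

lemma tendsto_amplitude (hV : 0 < V₀) : Tendsto (amplitude V₀) (𝓝[>] 0) atTop := by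
  have h1 : Tendsto (fun μ : ℝ => 4 * V₀ / μ) (𝓝[>] 0) atTop := by
    simp only [div_eq_mul_inv]
    exact tendsto_inv_nhdsGT_zero.const_mul_atTop (by positivity)
  exact (tendsto_rpow_atTop (by norm_num)).comp h1

end amplitude

/-- The bifurcation curve: the norm of the nontrivial nonnegative solutions for `lam`. -/
noncomputable def bifurcationCurve (V₀ R lam : ℝ) : ℝ :=
  amplitude V₀ (lam * shape (R * √lam))

/-- The parameter `lam` for which the flat solution fills the whole interval. -/
noncomputable def flatParameter (R : ℝ) : ℝ := (halfWidth 1 / R) ^ 2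

section curve

variable {V₀ R lam : ℝ} {U : ℝ → ℝ}

lemma lambdaOne_pos (hR : 0 < R) : 0 < lambdaOne R := by
  unfold lambdaOne; positivity

lemma lambdaOne_lt_iff (hR : 0 < R) : lambdaOne R < lam ↔ Real.pi / 2 < R * √lam := by
  rw [lambdaOne, ← Real.lt_sqrt (by positivity), div_lt_iff₀ (by positivity),
    div_lt_iff₀ (by norm_num)]
  constructor <;> intro h <;> linarith

lemma le_flatParameter_iff (hR : 0 < R) : lam ≤ flatParameter R ↔ R * √lam ≤ halfWidth 1 := by
  have := halfWidth_pos one_mem_Icc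
  rw [flatParameter, ← Real.sqrt_le_left (by positivity), le_div_iff₀ hR, mul_comm]

lemma mul_sqrt_flatParameter (hR : 0 < R) : R * √(flatParameter R) = halfWidth 1 := by
  have := halfWidth_pos one_mem_Icc
  rw [flatParameter, Real.sqrt_sq (by positivity)]
  field_simp

lemma lambdaOne_lt_flatParameter (hR : 0 < R) : lambdaOne R < flatParameter R := by
  rw [lambdaOne_lt_iff hR, mul_sqrt_flatParameter hR]
  exact pi_div_two_lt_halfWidth (by simp)

lemma bumpRadius_le_iff (hlam : 0 < lam) {q : ℝ} :
    bumpRadius lam q ≤ R ↔ halfWidth q ≤ R * √lam :=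
  div_le_iff₀ (Real.sqrt_pos.mpr hlam)

lemma bumpRadius_eq_iff (hlam : 0 < lam) {q : ℝ} :
    bumpRadius lam q = R ↔ halfWidth q = R * √lam :=
  div_eq_iff (Real.sqrt_pos.mpr hlam).ne'

lemma mul_shape_pos (hR : 0 < R) (h : lambdaOne R < lam) : 0 < lam * shape (R * √lam) :=
  mul_pos ((lambdaOne_pos hR).trans h) (shape_mem ((lambdaOne_lt_iff hR).mp h)).1

lemma supNorm_eq {s : ℝ} (hs : s ∈ Icc (-R) R) (h0 : ∀ x ∈ Icc (-R) R, 0 ≤ U x)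
    (h : ∀ x ∈ Icc (-R) R, U x ≤ U s) : supNorm R U = U s := by
  refine IsGreatest.csSup_eq ⟨⟨s, hs, abs_of_nonneg (h0 s hs)⟩, ?_⟩
  rintro _ ⟨x, hx, rfl⟩
  exact (abs_of_nonneg (h0 x hx)).trans_le (h x hx)

lemma IsNonnegSolution.lambdaOne_lt_and_eq_shape (hV : 0 < V₀) (hR : 0 < R)
    (h : IsNonnegSolution V₀ R lam U) {s : ℝ} (hs : s ∈ Icc (-R) R) (hne : U s ≠ 0) :
    lambdaOne R < lam ∧ ∃ a b, -R ≤ a ∧ s ∈ Ioo a b ∧ b ≤ R ∧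
      b - a = 2 * bumpRadius lam (shape (R * √lam)) ∧
      EqOn U (fun s => bump lam (bifurcationCurve V₀ R lam) (shape (R * √lam))
        (s - (a + b) / 2)) (Icc a b) := by
  obtain ⟨a, b, M, q, ha, hsab, hb, hlam, hM, hq, hrel, hlen, heq, hor⟩ := h.exists_eq_bump hV hs hne
  have h1 : halfWidth q ≤ R * √lam := (bumpRadius_le_iff hlam).mp (by linarith)
  have h2 : q = 1 ∨ halfWidth q = R * √lam := hor.imp_right fun h' =>
    (bumpRadius_eq_iff hlam).mp (by rw [h'.1, h'.2] at hlen; linarith)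
  have hqs := eq_shape hq h1 h2
  have hMs := eq_amplitude (mul_pos hlam hq.1) hM hrel
  refine ⟨(lambdaOne_lt_iff hR).mpr ((pi_div_two_lt_halfWidth hq).trans_le h1),
    a, b, ha, hsab, hb, hqs ▸ hlen, ?_⟩
  rw [bifurcationCurve, ← hqs, ← hMs]
  exact heq

theorem IsNontrivialNonnegSolution.supNorm_eq (hV : 0 < V₀) (hR : 0 < R)
    (h : IsNontrivialNonnegSolution V₀ R lam U) :
    lambdaOne R < lam ∧ supNorm R U = bifurcationCurve V₀ R lam := by
  obtain ⟨hU, s₁, hs₁, hne⟩ := h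
  obtain ⟨s, hs, hmax⟩ := isCompact_Icc.exists_isMaxOn ⟨s₁, hs₁⟩ hU.continuousOn
  have hpos : 0 < U s := (lt_of_le_of_ne (hU.nonneg s₁ hs₁) hne.symm).trans_le (hmax hs₁)
  obtain ⟨h1, a, b, ha, hsab, hb, -, heq⟩ := hU.lambdaOne_lt_and_eq_shape hV hR hs hpos.ne'
  refine ⟨h1, (SingularEigenvalue.supNorm_eq hs hU.nonneg hmax).trans ?_⟩
  have hq := Ioc_subset_Icc_self (shape_mem ((lambdaOne_lt_iff hR).mp h1))
  have hM := amplitude_pos hV (mul_shape_pos hR h1)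
  apply le_antisymm
  · rw [heq (Ioo_subset_Icc_self hsab)]
    exact bump_le hM.le _
  · have hab := hsab.1.trans hsab.2
    have hm : (a + b) / 2 ∈ Icc a b := ⟨by linarith, by linarith⟩
    have h2 : U ((a + b) / 2) ≤ U s := hmax ⟨ha.trans hm.1, hm.2.trans hb⟩
    rw [heq hm] at h2
    simp only [sub_self, bump_zero hq] at h2
    exact h2

/-- Up to the flat parameter a nonnegative solution has a single positivity component, the whole
interval. -/
theorem IsNontrivialNonnegSolution.eqOn_bump (hV : 0 < V₀) (hR : 0 < R)
    (h : IsNontrivialNonnegSolution V₀ R lam U) (hle : lam ≤ flatParameter R) :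
    EqOn U (bump lam (bifurcationCurve V₀ R lam) (shape (R * √lam))) (Icc (-R) R) := by
  obtain ⟨hU, s, hs, hne⟩ := h
  obtain ⟨h1, a, b, ha, hsab, hb, hlen, heq⟩ := hU.lambdaOne_lt_and_eq_shape hV hR hs hne
  have hlam := (lambdaOne_pos hR).trans h1
  have hr : bumpRadius lam (shape (R * √lam)) = R := (bumpRadius_eq_iff hlam).mpr
    (halfWidth_shape ((lambdaOne_lt_iff hR).mp h1) ((le_flatParameter_iff hR).mp hle))
  rw [hr] at hlen
  obtain rfl : a = -R := by linarith
  obtain rfl : b = R := by linarith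
  simpa using heq

theorem IsPositiveSolution.le_flatParameter (hV : 0 < V₀) (hR : 0 < R)
    (h : IsPositiveSolution V₀ R lam U) : lam ≤ flatParameter R := by
  obtain ⟨M, q, hlam, -, hq, -, hlen, -⟩ := h.solvesOn.exists_eq_bump hV (by linarith)
    h.continuousOn h.left_eq h.right_eq
  rw [le_flatParameter_iff hR, ← (bumpRadius_eq_iff hlam).mp (by linarith : bumpRadius lam q = R)]
  exact strictMonoOn_halfWidth.monotoneOn (Ioc_subset_Icc_self hq) one_mem_Icc hq.2

theorem isPositiveSolution_bump (hV : 0 < V₀) (hR : 0 < R) (h1 : lambdaOne R < lam)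
    (h2 : lam ≤ flatParameter R) :
    IsPositiveSolution V₀ R lam
      (bump lam (bifurcationCurve V₀ R lam) (shape (R * √lam))) := by
  have hlam := (lambdaOne_pos hR).trans h1
  have hx := (lambdaOne_lt_iff hR).mp h1
  have hq := Ioc_subset_Icc_self (shape_mem hx)
  have hr : bumpRadius lam (shape (R * √lam)) = R := (bumpRadius_eq_iff hlam).mpr
    (halfWidth_shape hx ((le_flatParameter_iff hR).mp h2))
  have hμ := mul_shape_pos hR h1
  have hs := solvesOn_bump hlam (amplitude_pos hV hμ) hq (amplitude_spec hV hμ)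
  have hl := bump_neg_radius (M := bifurcationCurve V₀ R lam) hlam hq
  have hr' := bump_radius (M := bifurcationCurve V₀ R lam) hlam hq
  rw [hr] at hs hl hr'
  exact hs.isPositiveSolution (continuous_bump hq).continuousOn hl hr'

theorem exists_isNontrivialNonnegSolution (hV : 0 < V₀) (hR : 0 < R) (h1 : lambdaOne R < lam) :
    ∃ U, IsNontrivialNonnegSolution V₀ R lam U := by
  have hlam := (lambdaOne_pos hR).trans h1
  rcases le_total lam (flatParameter R) with h2 | h2
  · exact ⟨_, (isPositiveSolution_bump hV hR h1 h2).isNontrivialNonnegSolution hR⟩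
  · refine ⟨_, isNontrivialNonnegSolution_flatBump hV hlam (amplitude_pos hV hlam)
      (amplitude_spec hV hlam) ((bumpRadius_le_iff hlam).mpr ?_)⟩
    rw [← mul_sqrt_flatParameter hR]
    gcongr

/-- A positive solution is flat exactly when its boundary slope `√(1 - q)` vanishes. -/
theorem IsPositiveSolution.isFlat_iff (hV : 0 < V₀) (hR : 0 < R)
    (h : IsPositiveSolution V₀ R lam U) : IsFlat R U ↔ lam = flatParameter R := by
  have hn := h.isNontrivialNonnegSolution hR
  have h1 := (hn.supNorm_eq hV hR).1
  have h2 := h.le_flatParameter hV hR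
  have heq := hn.eqOn_bump hV hR h2
  have hlam := (lambdaOne_pos hR).trans h1
  have hx := (lambdaOne_lt_iff hR).mp h1
  have hG := halfWidth_shape hx ((le_flatParameter_iff hR).mp h2)
  have hr : bumpRadius lam (shape (R * √lam)) = R := (bumpRadius_eq_iff hlam).mpr hG
  have hq := Ioc_subset_Icc_self (shape_mem hx)
  have hM := amplitude_pos hV (mul_shape_pos hR h1)
  have dl := hasDerivWithinAt_bump_left (M := bifurcationCurve V₀ R lam) hlam hq
  have dr := hasDerivWithinAt_bump_right (M := bifurcationCurve V₀ R lam) hlam hq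
  rw [hr] at dl dr
  replace dl := (dl.mono (Icc_subset_Ici_self : Icc (-R) R ⊆ Ici (-R))).congr heq (heq ⟨le_rfl, by linarith⟩)
  replace dr := (dr.mono (Icc_subset_Iic_self : Icc (-R) R ⊆ Iic R)).congr heq (heq ⟨by linarith, le_rfl⟩)
  constructor
  · rintro ⟨-, hf⟩
    have h0 := (uniqueDiffOn_Icc (show -R < R by linarith) R ⟨by linarith, le_rfl⟩).eq_deriv _ dr hf
    have hpos : 0 < bifurcationCurve V₀ R lam * √lam := mul_pos hM (Real.sqrt_pos.mpr hlam)
    have h3 : √(1 - shape (R * √lam)) = 0 := by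
      rcases mul_eq_zero.mp (neg_eq_zero.mp h0) with h' | h'
      · exact absurd h' hpos.ne'
      · exact h'
    rw [Real.sqrt_eq_zero (by linarith [hq.2])] at h3
    have h4 : shape (R * √lam) = 1 := by linarith
    rw [h4, ← mul_sqrt_flatParameter hR] at hG
    have h5 : √(flatParameter R) = √lam := mul_left_cancel₀ hR.ne' hG
    exact ((Real.sqrt_inj ((lambdaOne_pos hR).trans (lambdaOne_lt_flatParameter hR)).le
      hlam.le).mp h5).symm
  · intro hl
    have h4 : shape (R * √lam) = 1 := by
      rw [hl, mul_sqrt_flatParameter hR]; exact shape_of_ge le_rfl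
    rw [h4, sub_self, Real.sqrt_zero, mul_zero] at dl dr
    rw [neg_zero] at dr
    exact ⟨dl, dr⟩

lemma continuousOn_bifurcationCurve (hV : 0 < V₀) (hR : 0 < R) :
    ContinuousOn (bifurcationCurve V₀ R) (Ioi (lambdaOne R)) := by
  intro lam hlam
  obtain ⟨d, -, hd⟩ := exists_hasDerivAt_amplitude hV (mul_shape_pos hR hlam)
  have hs := continuous_shape
  refine ContinuousAt.continuousWithinAt ?_
  exact ContinuousAt.comp (f := fun lam => lam * shape (R * √lam)) hd.continuousAt
    (Continuous.continuousAt (by fun_prop))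

lemma strictAntiOn_bifurcationCurve (hV : 0 < V₀) (hR : 0 < R) :
    StrictAntiOn (bifurcationCurve V₀ R) (Ioi (lambdaOne R)) := by
  intro x hx y hy hxy
  refine amplitude_lt hV (mul_shape_pos hR hx) ?_
  have hx0 := (lambdaOne_pos hR).trans hx
  have h1 : shape (R * √x) ≤ shape (R * √y) := monotone_shape (by gcongr)
  have h2 := (shape_mem ((lambdaOne_lt_iff hR).mp hx)).1
  have h3 := (shape_mem ((lambdaOne_lt_iff hR).mp hy)).1
  nlinarith

lemma tendsto_bifurcationCurve (hV : 0 < V₀) (hR : 0 < R) :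
    Tendsto (bifurcationCurve V₀ R) (𝓝[>] (lambdaOne R)) atTop := by
  refine (tendsto_amplitude hV).comp (tendsto_nhdsWithin_iff.mpr ⟨?_, ?_⟩)
  · have hs := continuous_shape
    have hc : Continuous fun lam => lam * shape (R * √lam) := by fun_prop
    have h0 : lambdaOne R * shape (R * √(lambdaOne R)) = 0 := by
      have : R * √(lambdaOne R) = Real.pi / 2 := by
        rw [lambdaOne, Real.sqrt_sq (by positivity)]
        field_simp
      rw [this, shape, halfWidthInv_pi_div_two]
      simp
    have := hc.tendsto (lambdaOne R)
    rw [h0] at this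
    exact this.mono_left nhdsWithin_le_nhds
  · filter_upwards [self_mem_nhdsWithin] with lam hlam using mul_shape_pos hR hlam

/-- At the flat parameter the left derivative of the curve has the extra contribution of
`shape`, which is constant to the right of it. -/
theorem exists_one_sided_derivatives (hV : 0 < V₀) (hR : 0 < R) :
    ∃ a b : ℝ, a < b ∧
      HasDerivWithinAt (bifurcationCurve V₀ R) a (Iic (flatParameter R)) (flatParameter R) ∧
      HasDerivWithinAt (bifurcationCurve V₀ R) b (Ici (flatParameter R)) (flatParameter R) := by
  have hpos : 0 < flatParameter R := (lambdaOne_pos hR).trans (lambdaOne_lt_flatParameter hR)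
  obtain ⟨d, hd, hA⟩ := exists_hasDerivAt_amplitude hV hpos
  obtain ⟨e, he, hQ⟩ := exists_hasDerivAt_halfWidthInv
  have hval : bifurcationCurve V₀ R (flatParameter R) = amplitude V₀ (flatParameter R) := by
    rw [bifurcationCurve, mul_sqrt_flatParameter hR, shape_of_ge le_rfl, mul_one]
  have hs : HasDerivAt (fun lam => R * √lam) (R * (1 / (2 * √(flatParameter R))))
      (flatParameter R) := (Real.hasDerivAt_sqrt hpos.ne').const_mul R
  have hs0 := Real.sqrt_pos.mpr hpos
  set f := R * (1 / (2 * √(flatParameter R))) with hf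
  have hfpos : 0 < f := by positivity
  rw [← mul_sqrt_flatParameter hR] at hQ
  have hQ1 : halfWidthInv (R * √(flatParameter R)) = 1 := by
    rw [mul_sqrt_flatParameter hR, halfWidthInv_halfWidth_one]
  have hμ : HasDerivAt (fun lam => lam * halfWidthInv (R * √lam))
      (1 + flatParameter R * (e * f)) (flatParameter R) := by
    have := (hasDerivAt_id (flatParameter R)).mul (hQ.comp (flatParameter R) hs)
    exact this.congr_deriv (by simp [hQ1])
  have hl : HasDerivAt (fun lam => amplitude V₀ (lam * halfWidthInv (R * √lam)))
      (d * (1 + flatParameter R * (e * f))) (flatParameter R) := by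
    refine HasDerivAt.comp (h₂ := amplitude V₀) (flatParameter R) ?_ hμ
    rwa [hQ1, mul_one]
  refine ⟨_, d, ?_, hl.hasDerivWithinAt.congr (fun lam hlam => ?_) ?_,
    hA.hasDerivWithinAt.congr (fun lam hlam => ?_) hval⟩
  · have h1 : 0 < flatParameter R * (e * f) := by positivity
    nlinarith
  · rw [bifurcationCurve, shape_of_le ((le_flatParameter_iff hR).mp hlam)]
  · rw [hval, hQ1, mul_one]
  · have h1 : R * √(flatParameter R) ≤ R * √lam := by
      have : flatParameter R ≤ lam := hlam
      gcongr
    rw [mul_sqrt_flatParameter hR] at h1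
    rw [bifurcationCurve, shape_of_ge h1, mul_one]

theorem isBifurcationFromInfinity_iff (hV : 0 < V₀) (hR : 0 < R) (lam₀ : ℝ) :
    IsBifurcationFromInfinity V₀ R lam₀ ↔ lam₀ = lambdaOne R := by
  constructor
  · rintro ⟨lam, U, hU, hlim, hinf⟩
    have hn : ∀ n, lambdaOne R < lam n ∧ supNorm R (U n) = bifurcationCurve V₀ R (lam n) :=
      fun n => ((hU n).isNontrivialNonnegSolution hR).supNorm_eq hV hR
    have hge : lambdaOne R ≤ lam₀ := ge_of_tendsto' hlim fun n => (hn n).1.le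
    rcases hge.eq_or_lt with h | h
    · exact h.symm
    · have hc := (continuousOn_bifurcationCurve hV hR).continuousAt (Ioi_mem_nhds h)
      have := hc.tendsto.comp hlim
      exact absurd hinf (not_tendsto_atTop_of_tendsto_nhds (this.congr fun n => (hn n).2.symm))
  · rintro rfl
    have hlt := lambdaOne_lt_flatParameter hR
    obtain ⟨u, -, hu, hlim⟩ := exists_seq_strictAnti_tendsto' hlt
    have hpos : ∀ n, IsPositiveSolution V₀ R (u n)
        (bump (u n) (bifurcationCurve V₀ R (u n)) (shape (R * √(u n)))) := fun n =>
      isPositiveSolution_bump hV hR (hu n).1 (hu n).2.le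
    refine ⟨u, _, hpos, hlim, ?_⟩
    have h1 : Tendsto u atTop (𝓝[>] (lambdaOne R)) :=
      tendsto_nhdsWithin_iff.mpr ⟨hlim, Eventually.of_forall fun n => (hu n).1⟩
    refine ((tendsto_bifurcationCurve hV hR).comp h1).congr fun n => ?_
    exact (((hpos n).isNontrivialNonnegSolution hR).supNorm_eq hV hR).2.symm

theorem bifurcationDiagram_eq (hV : 0 < V₀) (hR : 0 < R) :
    bifurcationDiagram V₀ R =
      {p : ℝ × ℝ | lambdaOne R < p.1 ∧ p.2 = bifurcationCurve V₀ R p.1} := by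
  ext ⟨lam, y⟩
  constructor
  · rintro ⟨U, hU, rfl⟩
    exact hU.supNorm_eq hV hR
  · rintro ⟨h1, h2⟩
    obtain ⟨U, hU⟩ := exists_isNontrivialNonnegSolution hV hR h1
    exact ⟨U, hU, (hU.supNorm_eq hV hR).2.trans h2.symm⟩

end curve

end SingularEigenvalue

theorem theorem32 (V₀ R : ℝ) (hV₀ : 0 < V₀) (hR : 0 < R) :
    -- `(π / (2R))²` is the first eigenvalue of the linear problem
    IsLeast {lam : ℝ | SingularEigenvalue.IsDirichletEigenvalue R lam}
      (SingularEigenvalue.lambdaOne R) ∧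
    ∃ (lamStar : ℝ) (Λ : ℝ → ℝ),
      SingularEigenvalue.lambdaOne R < lamStar ∧
      -- the bifurcation diagram is a curve, the graph of `Λ` over `(λ₁(R), ∞)`
      SingularEigenvalue.bifurcationDiagram V₀ R =
        {p : ℝ × ℝ | SingularEigenvalue.lambdaOne R < p.1 ∧ p.2 = Λ p.1} ∧
      ContinuousOn Λ (Ioi (SingularEigenvalue.lambdaOne R)) ∧
      (∀ (lam : ℝ) (U : ℝ → ℝ), SingularEigenvalue.IsPositiveSolution V₀ R lam U →
        SingularEigenvalue.supNorm R U = Λ lam) ∧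
      -- positive solutions exist exactly for `λ₁(R) < lam ≤ lamStar`
      (∀ lam : ℝ, (∃ U : ℝ → ℝ, SingularEigenvalue.IsPositiveSolution V₀ R lam U) ↔
        SingularEigenvalue.lambdaOne R < lam ∧ lam ≤ lamStar) ∧
      -- (i) bifurcation from infinity at `λ₁(R)`, and only there
      Tendsto Λ (𝓝[>] (SingularEigenvalue.lambdaOne R)) atTop ∧
      (∀ lam₀ : ℝ, SingularEigenvalue.IsBifurcationFromInfinity V₀ R lam₀ ↔
        lam₀ = SingularEigenvalue.lambdaOne R) ∧
      -- (ii) the curve is strictly decreasing, and solutions are unique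
      StrictAntiOn Λ (Ioi (SingularEigenvalue.lambdaOne R)) ∧
      (∀ (lam : ℝ) (U W : ℝ → ℝ), SingularEigenvalue.IsPositiveSolution V₀ R lam U →
        SingularEigenvalue.IsPositiveSolution V₀ R lam W → EqOn U W (Icc (-R) R)) ∧
      (∀ lam : ℝ, lam ≤ lamStar → ∀ U W : ℝ → ℝ,
        SingularEigenvalue.IsNontrivialNonnegSolution V₀ R lam U →
        SingularEigenvalue.IsNontrivialNonnegSolution V₀ R lam W → EqOn U W (Icc (-R) R)) ∧
      -- (iii) the curve has a corner at `lamStar`, so it is not `C¹` there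
      ¬ ContDiffAt ℝ 1 Λ lamStar ∧
      (∃ a b : ℝ, a < b ∧ HasDerivWithinAt Λ a (Iic lamStar) lamStar ∧
        HasDerivWithinAt Λ b (Ici lamStar) lamStar) ∧
      -- and `lamStar` is the parameter of the flat solution
      (∃ U : ℝ → ℝ, SingularEigenvalue.IsPositiveSolution V₀ R lamStar U ∧
        SingularEigenvalue.IsFlat R U) ∧
      (∀ (lam : ℝ) (U : ℝ → ℝ), SingularEigenvalue.IsPositiveSolution V₀ R lam U →
        (SingularEigenvalue.IsFlat R U ↔ lam = lamStar)) := by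
  refine ⟨SingularEigenvalue.isLeast_lambdaOne hR, SingularEigenvalue.flatParameter R,
    SingularEigenvalue.bifurcationCurve V₀ R, SingularEigenvalue.lambdaOne_lt_flatParameter hR,
    SingularEigenvalue.bifurcationDiagram_eq hV₀ hR,
    SingularEigenvalue.continuousOn_bifurcationCurve hV₀ hR,
    fun lam U hU => ((hU.isNontrivialNonnegSolution hR).supNorm_eq hV₀ hR).2,
    fun lam => ⟨?_, fun h => ⟨_, SingularEigenvalue.isPositiveSolution_bump hV₀ hR h.1 h.2⟩⟩,
    SingularEigenvalue.tendsto_bifurcationCurve hV₀ hR,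
    SingularEigenvalue.isBifurcationFromInfinity_iff hV₀ hR,
    SingularEigenvalue.strictAntiOn_bifurcationCurve hV₀ hR,
    fun lam U W hU hW => ?_,
    fun lam hle U W hU hW => (hU.eqOn_bump hV₀ hR hle).trans (hW.eqOn_bump hV₀ hR hle).symm,
    ?_, SingularEigenvalue.exists_one_sided_derivatives hV₀ hR, ?_,
    fun lam U hU => hU.isFlat_iff hV₀ hR⟩
  · rintro ⟨U, hU⟩
    exact ⟨((hU.isNontrivialNonnegSolution hR).supNorm_eq hV₀ hR).1, hU.le_flatParameter hV₀ hR⟩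
  · have hle := hU.le_flatParameter hV₀ hR
    exact ((hU.isNontrivialNonnegSolution hR).eqOn_bump hV₀ hR hle).trans
      ((hW.isNontrivialNonnegSolution hR).eqOn_bump hV₀ hR hle).symm
  · intro hC
    obtain ⟨a, b, hab, ha, hb⟩ := SingularEigenvalue.exists_one_sided_derivatives hV₀ hR
    have hd := (hC.differentiableAt (by norm_num)).hasDerivAt
    have h1 := (uniqueDiffWithinAt_Iic _).eq_deriv _ ha hd.hasDerivWithinAt
    have h2 := (uniqueDiffWithinAt_Ici _).eq_deriv _ hb hd.hasDerivWithinAt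
    exact hab.ne (h1.trans h2.symm)
  · have hU := SingularEigenvalue.isPositiveSolution_bump hV₀ hR
      (SingularEigenvalue.lambdaOne_lt_flatParameter hR) le_rfl
    exact ⟨_, hU, (hU.isFlat_iff hV₀ hR).mpr rfl⟩
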